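/- Let $\mathcal Y$, $\mathcal L$ and $\mathcal P$ be finite sets (measurement outcomes, auxiliary labels, parameter values; for instance $\mathcal P=\{a,b\}$), and for every $p\in\mathcal P$ let $(V^p_{y,\mu})_{y\in\mathcal Y,\mu\in\mathcal L}$ be complex $d\times d$ matrices with $\sum_{y,\mu}(V^p_{y,\mu})^\dagger V^p_{y,\mu}=\mathbb 1$. Put $\mathbf K^p_y(\rho)=\sum_\mu V^p_{y,\mu}\,\rho\,(V^p_{y,\mu})^\dagger$ and $\Phi^p=\sum_{y}\mathbf K^p_y$. A state is a positive semidefinite $d\times d$ matrix of trace $1$; a state $\rho$ is invariant for $\Phi^p$ if $\Phi^p(\rho)=\rho$, and it is a minimal invariant state if, moreover, no invariant state of $\Phi^p$ has its support (range) strictly included in the support of $\rho$. Assume that every $\Phi^p$ is faithful, i.e. has an invariant state of full rank. For a state $\rho$ let $\mathbb P^p_\rho$ be the unique probability measure on $\Omega=\mathcal Y^{\mathbb N}$ (with the cylinder $\sigma$-algebra) such that for all $n$ and $y_0,\dots,y_{n-1}\in\mathcal Y$ $$\mathbb P^p_\rho(\{\omega:\omega_0=y_0,\dots,\omega_{n-1}=y_{n-1}\})=\operatorname{Tr}\big(\mathbf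 K^p_{y_{n-1}}\circ\cdots\circ\mathbf K^p_{y_0}(\rho)\big).$$ Assume the identifiability condition (ID): for all $p\neq q$ in $\mathcal P$, every minimal invariant state $\sigma$ of $\Phi^p$ and every minimal invariant state $\tau$ of $\Phi^q$, one has $\mathbb P^p_\sigma\neq\mathbb P^q_\tau$. Let $\hat\rho_0$ be a state of full rank, and let $(\pi_0^p)_{p\in\mathcal P}$ satisfy $\pi_0^p>0$ for all $p$ and $\sum_p\pi_0^p=1$. On $\mathbb C^{\mathcal P}\otimes\mathbb C^d$ put $\tilde V_{y,\mu}=\operatorname{diag}(V^p_{y,\mu})_{p\in\mathcal P}$ (block-diagonal) and $\tilde{\mathbf K}_y(\Xi)=\sum_\mu\tilde V_{y,\mu}\,\Xi\,\tilde V_{y,\mu}^\dagger$, and for a record $\omega=(y_0,y_1,\dots)\in\Omega$ define $$\hat\Xi_0=\operatorname{diag}(\pi_0^p\hat\rho_0)_{p\in\mathcal P},\qquad \hat\Xi_{n+1}=\frac{\tilde{\mathbf K}_{y_n}(\hat\Xi_n)}{\operatorname{Tr}\tilde{\mathbf K}_{y_n}(\hat\Xi_n)} .$$ Let $M^p$ be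 the operator that acts on the $p$-th block as the orthogonal projector onto the span of the supports of the minimal invariant states of $\Phi^p$ and vanishes on the other blocks, and let $\pi^p_n=\operatorname{Tr}(M^p\hat\Xi_n)$ be the posterior weight of $p$. Then, for every true parameter $p^*\in\mathcal P$ and every state $\rho_0$, $\mathbb P^{p^*}_{\rho_0}$-almost surely, $$\lim_{n\to\infty}\pi_n^{p^*}=1\qquad\text{and}\qquad \lim_{n\to\infty}\pi_n^{p}=0\quad\text{for all }p\neq p^*.$$ -/

import Mathlib

open Filter Topology MeasureTheory ProbabilityTheory
open scoped ENNReal Matrix ComplexOrder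

noncomputable section

namespace QTraj

/-! ### Instruments, channels and invariant states

`V y μ` (with `y` a measurement outcome and `μ` an auxiliary label) is a family of Kraus matrices
on the Hilbert space `ℂⁿ`, `n` a finite index type. -/

section Channels

variable {n Y L : Type*} [Fintype n] [DecidableEq n] [Fintype Y] [Fintype L]

/-- Density matrices. -/
def IsState (ρ : Matrix n n ℂ) : Prop :=
  ρ.PosSemidef ∧ ρ.trace = 1

/-- The normalisation `∑_{y,μ} V_{y,μ}† V_{y,μ} = 1`. -/
def IsKraus (V : Y → L → Matrix n n ℂ) : Prop :=
  ∑ y, ∑ μ, (V y μ)ᴴ * V y μ = 1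

/-- `K_y(ρ) = ∑_μ V_{y,μ} ρ V_{y,μ}†`. -/
def krausOp (V : Y → L → Matrix n n ℂ) (y : Y) (ρ : Matrix n n ℂ) : Matrix n n ℂ :=
  ∑ μ, V y μ * ρ * (V y μ)ᴴ

/-- The quantum channel `Φ = ∑_y K_y`. -/
def channel (V : Y → L → Matrix n n ℂ) (ρ : Matrix n n ℂ) : Matrix n n ℂ :=
  ∑ y, krausOp V y ρ

/-- Invariant states of the channel. -/
def IsInvariantState (V : Y → L → Matrix n n ℂ) (ρ : Matrix n n ℂ) : Prop :=
  IsState ρ ∧ channel V ρ = ρ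

/-- The support of a state: the range of the corresponding operator on `ℂⁿ`. -/
def support (ρ : Matrix n n ℂ) : Submodule ℂ (EuclideanSpace ℂ n) :=
  LinearMap.range (Matrix.toEuclideanLin ρ)

/-- A minimal invariant state: no invariant state has a strictly smaller support. -/
def IsMinimalInvariantState (V : Y → L → Matrix n n ℂ) (ρ : Matrix n n ℂ) : Prop :=
  IsInvariantState V ρ ∧ ∀ σ, IsInvariantState V σ → ¬ support σ < support ρ

/-- A faithful channel: there is a full-rank invariant state. -/
def IsFaithful (V : Y → L → Matrix n n ℂ) : Prop :=
  ∃ ρ, IsInvariantState V ρ ∧ ρ.PosDef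

/-- The span of all minimal subspaces, that is, of the supports of the minimal invariant states. -/
def minimalSpan (V : Y → L → Matrix n n ℂ) : Submodule ℂ (EuclideanSpace ℂ n) :=
  ⨆ ρ ∈ {ρ | IsMinimalInvariantState V ρ}, support ρ

/-- The orthogonal projector onto the span of the minimal subspaces; it is the sum `∑_i M_i` of the
orthogonal projectors onto the subspaces of any orthogonal decomposition of that span into minimal
subspaces. -/
def minimalProjector (V : Y → L → Matrix n n ℂ) : Matrix n n ℂ :=
  Matrix.toEuclideanLin.symm ((minimalSpan V).starProjection : EuclideanSpace ℂ n →ₗ[ℂ] _)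

/-! ### Trajectories

A measurement record is a sequence `ω : ℕ → Y`. -/

/-- `K_{ω (k-1)} ∘ ⋯ ∘ K_{ω 0} (ρ)`. -/
def unnormalized (V : Y → L → Matrix n n ℂ) (ρ : Matrix n n ℂ) (ω : ℕ → Y) : ℕ → Matrix n n ℂ
  | 0 => ρ
  | k + 1 => krausOp V (ω k) (unnormalized V ρ ω k)

/-- The quantum trajectory started from `ρ` and driven by the record `ω`: the state at time `k + 1`
is `K_{ω k}(ρ_k) / Tr K_{ω k}(ρ_k)`. -/
def trajectory (V : Y → L → Matrix n n ℂ) (ρ : Matrix n n ℂ) (ω : ℕ → Y) : ℕ → Matrix n n ℂ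
  | 0 => ρ
  | k + 1 => (krausOp V (ω k) (trajectory V ρ ω k)).trace⁻¹ • krausOp V (ω k) (trajectory V ρ ω k)

lemma sum_trace_krausOp {V : Y → L → Matrix n n ℂ} (hV : IsKraus V) (ρ : Matrix n n ℂ) :
    ∑ y, (krausOp V y ρ).trace = ρ.trace := by
  have : ∀ y μ, (V y μ * ρ * (V y μ)ᴴ).trace = ((V y μ)ᴴ * V y μ * ρ).trace := by
    intro y μ
    rw [Matrix.trace_mul_comm, Matrix.mul_assoc]
  simp only [krausOp, Matrix.trace_sum, this]
  conv_rhs => rw [← one_mul ρ, ← hV]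
  simp only [Finset.sum_mul, Matrix.trace_sum]

lemma posSemidef_unnormalized (V : Y → L → Matrix n n ℂ) {ρ : Matrix n n ℂ} (hρ : ρ.PosSemidef)
    (ω : ℕ → Y) (k : ℕ) : (unnormalized V ρ ω k).PosSemidef := by
  induction k with
  | zero => exact hρ
  | succ k ih =>
    exact Matrix.posSemidef_sum _ fun μ _ => ih.mul_mul_conjTranspose_same _

lemma unnormalized_congr (V : Y → L → Matrix n n ℂ) (ρ : Matrix n n ℂ) {ω ω' : ℕ → Y} {k : ℕ}
    (h : ∀ i < k, ω i = ω' i) : unnormalized V ρ ω k = unnormalized V ρ ω' k := by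
  induction k with
  | zero => rfl
  | succ k ih =>
    simp only [unnormalized]
    rw [ih fun i hi => h i (by omega), h k (by omega)]

end Channels

/-! ### The law of the measurement record -/

section Law

variable {n Y L : Type*} [Fintype n] [DecidableEq n] [Fintype Y] [Fintype L] [MeasurableSpace Y]

/-- The cylinder of all records that agree with `ω` at the times `0, …, k - 1`. -/
def cyl (ω : ℕ → Y) (k : ℕ) : Set (ℕ → Y) := {ω' | ∀ i < k, ω' i = ω i}

/-- `P` is a probability measure on records with
`P (y_0, …, y_{k-1}) = Tr (K_{y_{k-1}} ∘ ⋯ ∘ K_{y_0} (ρ))` on all cylinders. -/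
def IsOutputLaw (V : Y → L → Matrix n n ℂ) (ρ : Matrix n n ℂ) (P : Measure (ℕ → Y)) : Prop :=
  IsProbabilityMeasure P ∧
    ∀ (ω : ℕ → Y) (k : ℕ), P (cyl ω k) = ENNReal.ofReal (unnormalized V ρ ω k).trace.re

open Classical in
/-- The law of the measurement record generated by the state `ρ`: the unique probability measure
with the prescribed values on cylinders (see `isOutputLaw_outputLaw` and `IsOutputLaw.unique`). -/
def outputLaw (V : Y → L → Matrix n n ℂ) (ρ : Matrix n n ℂ) : Measure (ℕ → Y) :=
  if h : ∃ P, IsOutputLaw V ρ P then h.choose else 0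

lemma exists_measure_of_weights [MeasurableSingletonClass Y] [Nonempty Y]
    (w : ℕ → (ℕ → Y) → ℝ≥0∞)
    (hw : ∀ k ω ω', (∀ i < k, ω i = ω' i) → w k ω = w k ω')
    (w0 : ∀ ω, w 0 ω = 1)
    (ws : ∀ k ω, ∑ y, w (k + 1) (Function.update ω k y) = w k ω) :
    ∃ P : Measure (ℕ → Y), IsProbabilityMeasure P ∧ ∀ ω k, P (cyl ω k) = w k ω := by
  classical
  let y0 : Y := Classical.arbitrary Y
  let ext : (k : ℕ) → (Finset.Iic k → Y) → ℕ → Y :=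
    fun k h i => if hi : i ∈ Finset.Iic k then h ⟨i, hi⟩ else y0
  have wle : ∀ k ω, w k ω ≤ 1 := by
    intro k
    induction k with
    | zero => intro ω; rw [w0]
    | succ k ih =>
      intro ω
      refine le_trans ?_ (ih ω)
      rw [← ws k ω]
      have := Finset.single_le_sum (f := fun y => w (k + 1) (Function.update ω k y))
        (fun _ _ => zero_le) (Finset.mem_univ (ω k))
      simpa using this
  have wtop : ∀ k ω, w k ω ≠ ⊤ := fun k ω => ((wle k ω).trans_lt ENNReal.one_lt_top).ne
  let κf : (k : ℕ) → (Finset.Iic k → Y) → Measure Y := fun k h =>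
    if w (k + 1) (ext k h) = 0 then Measure.dirac y0 else
      (w (k + 1) (ext k h))⁻¹ •
        ∑ y, w (k + 2) (Function.update (ext k h) (k + 1) y) • Measure.dirac y
  let κ : (k : ℕ) → Kernel (Finset.Iic k → Y) Y := fun k => ⟨κf k, Measurable.of_discrete⟩
  have κapp : ∀ k h, κ k h = κf k h := fun _ _ => rfl
  have hκ : ∀ k, IsMarkovKernel (κ k) := by
    intro k
    refine ⟨fun h => ?_⟩
    rw [κapp]
    simp only [κf]
    split_ifs with h0
    · infer_instance
    · refine ⟨?_⟩
      simp only [Measure.smul_apply, Measure.finsetSum_apply, measure_univ, smul_eq_mul, mul_one]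
      rw [ws (k + 1) (ext k h)]
      exact ENNReal.inv_mul_cancel h0 (wtop _ _)
  let μ0 : Measure Y := ∑ y, w 1 (fun _ => y) • Measure.dirac y
  have w1 : ∀ ω, w 1 ω = w 1 (fun _ => ω 0) := by
    intro ω
    apply hw
    intro i hi
    obtain rfl : i = 0 := by omega
    rfl
  have hμ0 : IsProbabilityMeasure μ0 := by
    refine ⟨?_⟩
    simp only [μ0, Measure.finsetSum_apply, Measure.smul_apply, measure_univ, smul_eq_mul, mul_one]
    rw [← w0 (fun _ => y0), ← ws 0 (fun _ => y0)]
    refine Finset.sum_congr rfl fun y _ => ?_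
    rw [w1 (Function.update _ _ _)]
    simp
  let P : Measure (ℕ → Y) := Kernel.trajMeasure (X := fun _ => Y) μ0 κ
  have hP : IsProbabilityMeasure P := inferInstanceAs
    (IsProbabilityMeasure (Kernel.trajMeasure (X := fun _ => Y) μ0 κ))
  refine ⟨P, hP, ?_⟩
  have cylP : ∀ (ω : ℕ → Y) k, cyl ω (k + 1) =
      (Preorder.frestrictLe (π := fun _ => Y) k) ⁻¹' {Preorder.frestrictLe k ω} := by
    intro ω k
    ext ω'
    simp only [cyl, Set.mem_ofPred_eq, Set.mem_preimage, Set.mem_singleton_iff, funext_iff,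
      Subtype.forall, Finset.mem_Iic, Preorder.frestrictLe_apply]
    constructor
    · intro h i hi; exact h i (by omega)
    · intro h i hi; exact h i (by omega)
  have key : ∀ k ω, P (cyl ω (k + 1)) = w (k + 1) ω := by
    intro k
    induction k with
    | zero =>
      intro ω
      have ms : MeasurableSet ({Preorder.frestrictLe (π := fun _ => Y) 0 ω} :
          Set (Finset.Iic 0 → Y)) := MeasurableSet.singleton _
      have hmap : P.map (Preorder.frestrictLe (π := fun _ => Y) 0) =
          μ0.map (MeasurableEquiv.piUnique (fun _ : Finset.Iic 0 => Y)).symm := by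
        change Measure.map _ (Measure.bind _ _) = _
        rw [Measure.map_comp _ _ (by fun_prop), Kernel.traj_map_frestrictLe_of_le le_rfl,
          Measure.deterministic_comp_eq_map]
        exact Measure.map_id
      rw [cylP, ← Measure.map_apply (by fun_prop) ms, hmap, Measure.map_apply (by fun_prop) ms]
      have hpre : (MeasurableEquiv.piUnique (fun _ : Finset.Iic 0 => Y)).symm ⁻¹'
          {Preorder.frestrictLe (π := fun _ => Y) 0 ω} = {ω 0} := by
        ext y
        simp only [Set.mem_preimage, Set.mem_singleton_iff]
        rw [MeasurableEquiv.symm_apply_eq]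
        rfl
      rw [hpre, w1 ω]
      simp only [μ0, Measure.finsetSum_apply, Measure.smul_apply, smul_eq_mul]
      rw [Finset.sum_eq_single (ω 0)]
      · simp
      · intro y _ hy
        simp [hy]
      · simp
    | succ k ih =>
      intro ω
      have hset : cyl ω (k + 2) = (fun x : ℕ → Y => (Preorder.frestrictLe (π := fun _ => Y) k x,
          x (k + 1))) ⁻¹' ({Preorder.frestrictLe k ω} ×ˢ {ω (k + 1)}) := by
        ext ω'
        simp only [cyl, Set.mem_ofPred_eq, Set.mem_preimage, Set.mem_prod, Set.mem_singleton_iff,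
          funext_iff, Subtype.forall, Finset.mem_Iic, Preorder.frestrictLe_apply]
        constructor
        · intro h; exact ⟨fun i hi => h i (by omega), h _ (by omega)⟩
        · rintro ⟨h1, h2⟩ i hi
          rcases Nat.lt_or_ge i (k + 1) with h | h
          · exact h1 i (by omega)
          · obtain rfl : i = k + 1 := by omega
            exact h2
      have := Kernel.map_frestrictLe_trajMeasure_compProd_eq_map_trajMeasure
        (X := fun _ => Y) (μ₀ := μ0) (κ := κ) (a := k)
      have ms : MeasurableSet ({Preorder.frestrictLe (π := fun _ => Y) k ω} :
          Set (Finset.Iic k → Y)) := MeasurableSet.singleton _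
      have ms' : MeasurableSet ({ω (k + 1)} : Set Y) := MeasurableSet.singleton _
      have h2 : P (cyl ω (k + 2)) = (P.map (Preorder.frestrictLe (π := fun _ => Y) k) ⊗ₘ κ k)
          ({Preorder.frestrictLe k ω} ×ˢ {ω (k + 1)}) := by
        rw [this, Measure.map_apply (by fun_prop) (ms.prod ms'), hset]
      rw [h2, Measure.compProd_apply_prod ms ms']
      rw [lintegral_singleton, Measure.map_apply (by fun_prop) ms, ← cylP, ih,
        κapp]
      have hext : ∀ i < k + 1, ext k (Preorder.frestrictLe k ω) i = ω i := by
        intro i hi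
        simp [ext, show i ≤ k by omega]
      have e1 : w (k + 1) (ext k (Preorder.frestrictLe k ω)) = w (k + 1) ω := hw _ _ _ hext
      have e2 : w (k + 2) (Function.update (ext k (Preorder.frestrictLe k ω)) (k + 1) (ω (k + 1)))
          = w (k + 2) ω := by
        apply hw
        intro i hi
        rcases Nat.lt_or_ge i (k + 1) with h | h
        · rw [Function.update_of_ne (by omega)]; exact hext i h
        · obtain rfl : i = k + 1 := by omega
          simp
      have le2 : w (k + 2) ω ≤ w (k + 1) ω := by
        rw [← ws (k + 1) ω]
        have := Finset.single_le_sum (f := fun y => w (k + 2) (Function.update ω (k + 1) y))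
          (fun _ _ => zero_le) (Finset.mem_univ (ω (k + 1)))
        simpa using this
      simp only [κf, e1]
      split_ifs with h0
      · rw [h0] at le2
        rw [h0, mul_zero]
        exact (le_antisymm le2 zero_le).symm
      · simp only [Measure.smul_apply, Measure.finsetSum_apply, smul_eq_mul]
        rw [Finset.sum_eq_single (ω (k + 1))]
        · rw [e2]
          simp only [Measure.dirac_apply, Set.indicator_of_mem, Set.mem_singleton_iff,
            Pi.one_apply, mul_one]
          rw [mul_comm, ← mul_assoc, ENNReal.mul_inv_cancel h0 (wtop _ _), one_mul]
        · intro y _ hy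
          simp [hy]
        · simp
  intro ω k
  cases k with
  | zero =>
    have : cyl ω 0 = Set.univ := by ext; simp [cyl]
    rw [this, measure_univ, w0]
  | succ k => exact key k ω

lemma IsOutputLaw.unique [MeasurableSingletonClass Y] {V : Y → L → Matrix n n ℂ}
    {ρ : Matrix n n ℂ} {P Q : Measure (ℕ → Y)} (hP : IsOutputLaw V ρ P) (hQ : IsOutputLaw V ρ Q) :
    P = Q := by
  obtain ⟨hP1, hP2⟩ := hP
  obtain ⟨hQ1, hQ2⟩ := hQ
  have hproj : IsProjectiveLimit P (fun I : Finset ℕ => Q.map I.restrict) := by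
    rw [isProjectiveLimit_nat_iff]
    · intro k
      refine Measure.ext_of_singleton fun h => ?_
      have ms : MeasurableSet ({h} : Set (Finset.Iic k → Y)) := MeasurableSet.singleton _
      have hpre : ∃ ω : ℕ → Y, h = Preorder.frestrictLe (π := fun _ => Y) k ω := by
        refine ⟨fun i => if hi : i ∈ Finset.Iic k then h ⟨i, hi⟩ else h ⟨0, by simp⟩, ?_⟩
        ext ⟨i, hi⟩
        have hi' : i ≤ k := by simpa using hi
        simp [hi']
      obtain ⟨ω, rfl⟩ := hpre
      have hset : cyl ω (k + 1) =
          (Preorder.frestrictLe (π := fun _ => Y) k) ⁻¹' {Preorder.frestrictLe k ω} := by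
        ext ω'
        simp only [cyl, Set.mem_ofPred_eq, Set.mem_preimage, Set.mem_singleton_iff, funext_iff,
          Subtype.forall, Finset.mem_Iic, Preorder.frestrictLe_apply]
        constructor
        · intro h i hi; exact h i (by omega)
        · intro h i hi; exact h i (by omega)
      rw [Measure.map_apply (by fun_prop) ms]
      change _ = Q.map (Preorder.frestrictLe (π := fun _ => Y) k) _
      rw [Measure.map_apply (by fun_prop) ms, ← hset, hP2, hQ2]
    · intro I J hJI
      change Q.map J.restrict = (Q.map I.restrict).map _
      rw [Measure.map_map (by fun_prop) (by fun_prop)]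
      rfl
  have hprojQ : IsProjectiveLimit Q (fun I : Finset ℕ => Q.map I.restrict) := fun I => rfl
  have : ∀ I : Finset ℕ, IsFiniteMeasure (Q.map (I.restrict (π := fun _ => Y))) :=
    fun I => inferInstance
  exact hproj.unique hprojQ

lemma exists_isOutputLaw [MeasurableSingletonClass Y] {V : Y → L → Matrix n n ℂ}
    {ρ : Matrix n n ℂ} (hV : IsKraus V) (hρ : IsState ρ) : ∃ P, IsOutputLaw V ρ P := by
  have hY : Nonempty Y := by
    by_contra hne
    rw [not_nonempty_iff] at hne
    have h := sum_trace_krausOp hV ρ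
    rw [hρ.2] at h
    simp at h
  refine exists_measure_of_weights (fun k ω => ENNReal.ofReal (unnormalized V ρ ω k).trace.re)
    ?_ ?_ ?_
  · intro k ω ω' h
    simp only [unnormalized_congr V ρ h]
  · intro ω
    simp [unnormalized, hρ.2]
  · intro k ω
    have hpos : ∀ y, 0 ≤ (unnormalized V ρ (Function.update ω k y) (k + 1)).trace.re := fun y =>
      (Complex.le_def.1 (posSemidef_unnormalized V hρ.1 _ _).trace_nonneg).1
    rw [← ENNReal.ofReal_sum_of_nonneg fun y _ => hpos y, ← sum_trace_krausOp hV, Complex.re_sum]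
    congr 1
    refine Finset.sum_congr rfl fun y _ => ?_
    simp only [unnormalized, Function.update_self]
    rw [unnormalized_congr V ρ (ω := Function.update ω k y) (ω' := ω)
      fun i hi => Function.update_of_ne (by omega) _ _]

theorem isOutputLaw_outputLaw [MeasurableSingletonClass Y] {V : Y → L → Matrix n n ℂ}
    {ρ : Matrix n n ℂ} (hV : IsKraus V) (hρ : IsState ρ) :
    IsOutputLaw V ρ (outputLaw V ρ) := by
  have h := exists_isOutputLaw hV hρ
  rw [outputLaw, dif_pos h]
  exact h.choose_spec

end Law

/-! ### The extended filter on `ℂⁿ ⊗ ℂ^Θ`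

`V p` is the family of Kraus matrices for the value `p` of the parameter. -/

section Filter

variable {Θ n Y L : Type*} [Fintype Θ] [DecidableEq Θ] [Fintype n] [DecidableEq n] [Fintype Y]
  [Fintype L]

/-- The Kraus matrices `diag (V^p_{y,μ})_p`. -/
def blockKraus (V : Θ → Y → L → Matrix n n ℂ) : Y → L → Matrix (n × Θ) (n × Θ) ℂ :=
  fun y μ => Matrix.blockDiagonal fun p => V p y μ

/-- The initial estimate `diag (π₀^p ρ̂₀)_p`. -/
def initialEstimate (π₀ : Θ → ℝ) (ρhat : Matrix n n ℂ) : Matrix (n × Θ) (n × Θ) ℂ :=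
  Matrix.blockDiagonal fun p => (π₀ p : ℂ) • ρhat

/-- The estimated trajectory `Ξ̂_k`, driven by the record `ω`. -/
def estimate (V : Θ → Y → L → Matrix n n ℂ) (π₀ : Θ → ℝ) (ρhat : Matrix n n ℂ) (ω : ℕ → Y)
    (k : ℕ) : Matrix (n × Θ) (n × Θ) ℂ :=
  trajectory (blockKraus V) (initialEstimate π₀ ρhat) ω k

/-- The projector `M^p`: in the block `p` it is the projector onto the span of the minimal subspaces
of `Φ^p`, and it vanishes in the other blocks. -/
def blockProjector (V : Θ → Y → L → Matrix n n ℂ) (p : Θ) : Matrix (n × Θ) (n × Θ) ℂ :=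
  Matrix.blockDiagonal (Pi.single p (minimalProjector (V p)))

/-- The posterior weight `π_k^p = Tr (M^p Ξ̂_k)`. -/
def posterior (V : Θ → Y → L → Matrix n n ℂ) (π₀ : Θ → ℝ) (ρhat : Matrix n n ℂ) (ω : ℕ → Y)
    (k : ℕ) (p : Θ) : ℝ :=
  (blockProjector V p * estimate V π₀ ρhat ω k).trace.re

/-- The identifiability condition (ID): for distinct values of the parameter, minimal invariant
states never generate the same law of the measurement record. -/
def Identifiable [MeasurableSpace Y] (V : Θ → Y → L → Matrix n n ℂ) : Prop :=
  ∀ p q, p ≠ q → ∀ σ τ, IsMinimalInvariantState (V p) σ → IsMinimalInvariantState (V q) τ →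
    outputLaw (V p) σ ≠ outputLaw (V q) τ

end Filter

end QTraj

end

noncomputable section

namespace QTraj

/-! ### Supports of positive matrices and the Loewner order -/

section MatrixOrder

open scoped Matrix.Norms.L2Operator MatrixOrder

variable {n : Type*} [Fintype n] [DecidableEq n]

/-! Faithfulness makes every `minimalProjector` the identity, so the posterior is Bayes' formula:
`π₀ p` times the probability of the observed cylinder under the law started from `ρhat`, normalised
over `p` (`posterior_eq`). It remains to see that the likelihood ratio Q(cyl)/P(cyl) of a wrong
value against the true one tends to 0 P-almost surely, both laws being started from `ρhat`. This
holds as soon as Q and P are mutually singular (`tendsto_likelihoodRatio`). Passing to the true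
initial state is free: `ρhat` has full rank, and a smaller support gives an absolutely continuous
law (`law_absolutelyContinuous`).

Singularity comes from ergodicity. By the same domination, `ρhat` may be replaced by full-rank
invariant states. These are nonnegative combinations of minimal invariant states
(`invariant_induction`), so it suffices to compare two minimal ones. The law of a minimal invariant
state τ is ergodic for the shift (`IsMinimalInvariantState.ergodic`): for a shift-invariant event A,
the quantity `law V ρ A` does not change when the channel is applied to ρ, hence not under Cesàro
averaging either; if 0 ≤ ρ ≤ τ, a subsequence of the averages converges to Tr(ρ) τ. Thus A is
independent of every cylinder, and so of itself. Distinct ergodic probability measures are mutually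
singular (`mutuallySingular_of_ergodic`), and (ID) supplies the distinctness. -/

lemma mem_support_iff {ρ : Matrix n n ℂ} {v : EuclideanSpace ℂ n} :
    v ∈ support ρ ↔ ∃ u : n → ℂ, ρ *ᵥ u = v.ofLp := by
  constructor
  · rintro ⟨u, rfl⟩
    exact ⟨u.ofLp, rfl⟩
  · rintro ⟨u, hu⟩
    exact ⟨WithLp.toLp 2 u, by ext i; simpa using congrFun hu i⟩

lemma support_eq_top {ρ : Matrix n n ℂ} (h : ρ.PosDef) : support ρ = ⊤ := by
  rw [eq_top_iff]
  refine fun v _ => mem_support_iff.2 ⟨ρ⁻¹ *ᵥ v.ofLp, ?_⟩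
  rw [Matrix.mulVec_mulVec, Matrix.mul_nonsing_inv _ ((Matrix.isUnit_iff_isUnit_det _).1
    h.isUnit), Matrix.one_mulVec]

lemma support_smul_le (c : ℂ) (ρ : Matrix n n ℂ) : support (c • ρ) ≤ support ρ := by
  intro v hv
  obtain ⟨u, hu⟩ := mem_support_iff.1 hv
  exact mem_support_iff.2 ⟨c • u, by rw [← hu, Matrix.mulVec_smul, Matrix.smul_mulVec]⟩

lemma support_smul {c : ℂ} (hc : c ≠ 0) (ρ : Matrix n n ℂ) : support (c • ρ) = support ρ := by
  refine le_antisymm (support_smul_le c ρ) ?_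
  simpa [smul_smul, hc] using support_smul_le c⁻¹ (c • ρ)

lemma support_add_le (ρ σ : Matrix n n ℂ) : support (ρ + σ) ≤ support ρ ⊔ support σ := by
  intro v hv
  obtain ⟨u, hu⟩ := mem_support_iff.1 hv
  have : v = WithLp.toLp 2 (ρ *ᵥ u) + WithLp.toLp 2 (σ *ᵥ u) := by
    ext i
    simp [← hu, Matrix.add_mulVec]
  rw [this]
  exact Submodule.add_mem_sup (mem_support_iff.2 ⟨u, rfl⟩) (mem_support_iff.2 ⟨u, rfl⟩)

lemma support_eq_orthogonal_ker {ρ : Matrix n n ℂ} (hρ : ρ.IsHermitian) :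
    support ρ = (LinearMap.ker (Matrix.toEuclideanLin ρ))ᗮ := by
  rw [LinearMap.orthogonal_ker, ← Matrix.toEuclideanLin_conjTranspose_eq_adjoint, hρ.eq]
  rfl

/-- If σv = 0, then 0 ≤ ⟨v, τv⟩ ≤ ⟨v, σv⟩ = 0, so τv = 0; inclusion of kernels becomes inclusion of
ranges on taking orthogonal complements. -/
lemma support_le_of_le {σ τ : Matrix n n ℂ} (hτ : 0 ≤ τ) (h : τ ≤ σ) :
    support τ ≤ support σ := by
  have hτ' := Matrix.nonneg_iff_posSemidef.1 hτ
  have hσ' := Matrix.nonneg_iff_posSemidef.1 (hτ.trans h)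
  rw [support_eq_orthogonal_ker hτ'.1, support_eq_orthogonal_ker hσ'.1]
  apply Submodule.orthogonal_le
  intro v hv
  have hv' : σ *ᵥ v.ofLp = 0 := by
    have := congrArg WithLp.ofLp (LinearMap.mem_ker.1 hv)
    simpa [Matrix.toLpLin_apply] using this
  have h1 := (Matrix.le_iff.1 h).dotProduct_mulVec_nonneg v.ofLp
  rw [Matrix.sub_mulVec, hv', zero_sub, dotProduct_neg] at h1
  have h2 := hτ'.dotProduct_mulVec_nonneg v.ofLp
  have h3 : τ *ᵥ v.ofLp = 0 :=
    (hτ'.dotProduct_mulVec_zero_iff _).1 (le_antisymm (by simpa using h1) h2)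
  rw [LinearMap.mem_ker]
  ext i
  simpa [Matrix.toLpLin_apply] using congrFun h3 i

/-- Write √τ = σX, which is possible because √τ and τ have the same range. Then τ = σXX*σ ≤ ‖XX*‖ σ²
≤ ‖XX*‖ ‖σ‖ σ. This converse of `support_le_of_le` turns inclusions of supports into domination of
laws. -/
lemma exists_le_smul_of_support_le {σ τ : Matrix n n ℂ} (hσ : 0 ≤ σ) (hτ : 0 ≤ τ)
    (h : support τ ≤ support σ) : ∃ C : ℝ, 0 < C ∧ τ ≤ C • σ := by
  set S := CFC.sqrt τ with hS
  have hS0 : 0 ≤ S := CFC.sqrt_nonneg τ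
  have hSS : S * S = τ := CFC.sqrt_mul_sqrt_self τ hτ
  have hSh : Sᴴ = S := (Matrix.nonneg_iff_posSemidef.1 hS0).1
  have hsupp : support S ≤ support σ := by
    refine le_trans (le_of_eq ?_) h
    have := LinearMap.range_self_comp_adjoint (Matrix.toEuclideanLin S)
    rw [← Matrix.toEuclideanLin_conjTranspose_eq_adjoint, hSh] at this
    unfold support
    rw [← this, ← hSS]
    congr 1
    ext v i
    simp [Matrix.toLpLin_apply]
  have hX : ∃ X : Matrix n n ℂ, S = σ * X := by
    have : ∀ j, ∃ u : n → ℂ, σ *ᵥ u = S.col j := by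
      intro j
      have := hsupp (mem_support_iff.2 ⟨Pi.single j 1, rfl⟩ :
        WithLp.toLp 2 (S *ᵥ Pi.single j 1) ∈ support S)
      obtain ⟨u, hu⟩ := mem_support_iff.1 this
      exact ⟨u, by rw [hu]; simp⟩
    choose u hu using this
    refine ⟨Matrix.of fun i j => u j i, ?_⟩
    ext i j
    have := congrFun (hu j) i
    simp only [Matrix.col_apply] at this
    rw [← this]
    rfl
  obtain ⟨X, hX⟩ := hX
  have hσh : star σ = σ := (Matrix.nonneg_iff_posSemidef.1 hσ).1
  have h1 : τ ≤ ‖X * star X‖ • (σ * σ) := by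
    have : τ = σ * (X * star X) * star σ := by
      rw [← hSS]
      nth_rw 2 [← hSh]
      rw [hX, Matrix.conjTranspose_mul, ← Matrix.star_eq_conjTranspose,
        ← Matrix.star_eq_conjTranspose]
      simp only [mul_assoc]
    rw [this]
    refine (CStarAlgebra.star_right_conjugate_le_norm_smul (.mul_star_self X)).trans ?_
    rw [hσh]
  have h2 : σ * σ ≤ ‖σ‖ • σ := by
    -- With T = √σ, σ² = TσT ≤ ‖σ‖ T² = ‖σ‖ σ.
    set T := CFC.sqrt σ
    have hTT : T * T = σ := CFC.sqrt_mul_sqrt_self σ hσ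
    have hTh : star T = T := (Matrix.nonneg_iff_posSemidef.1 (CFC.sqrt_nonneg σ)).1
    have := CStarAlgebra.star_left_conjugate_le_norm_smul (a := T) (b := σ) hσh
    rw [hTh, hTT] at this
    refine le_trans (le_of_eq ?_) this
    rw [← hTT]
    simp only [mul_assoc]
  -- The summand 1 only makes the constant strictly positive.
  refine ⟨‖X * star X‖ * ‖σ‖ + 1, by positivity, h1.trans ?_⟩
  calc ‖X * star X‖ • (σ * σ) ≤ ‖X * star X‖ • (‖σ‖ • σ) :=
        smul_le_smul_of_nonneg_left h2 (norm_nonneg _)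
    _ = (‖X * star X‖ * ‖σ‖) • σ := by rw [smul_smul]
    _ ≤ _ := smul_le_smul_of_nonneg_right (by linarith) hσ

omit [DecidableEq n] in
lemma trace_mono {σ τ : Matrix n n ℂ} (h : σ ≤ τ) : σ.trace.re ≤ τ.trace.re := by
  have := (Complex.le_def.1 (Matrix.le_iff.1 h).trace_nonneg).1
  simpa [Matrix.trace_sub] using this

omit [DecidableEq n] in
lemma trace_pos {τ : Matrix n n ℂ} (hτ : 0 ≤ τ) (h : τ ≠ 0) : 0 < τ.trace.re := by
  have hτ' := Matrix.nonneg_iff_posSemidef.1 hτ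
  have h0 := Complex.le_def.1 hτ'.trace_nonneg
  refine lt_of_le_of_ne h0.1 fun h1 => h (hτ'.trace_eq_zero_iff.1 ?_)
  exact Complex.ext h1.symm h0.2.symm

/-- Take the largest t with tτ ≤ σ. If σ - tτ still had the support of σ, it would dominate a
positive multiple of τ, and t could be increased. -/
lemma exists_sub_smul_support_lt {σ τ : Matrix n n ℂ} (hσ : 0 ≤ σ) (hτ : 0 ≤ τ) (hτ0 : τ ≠ 0)
    (h : support τ ≤ support σ) :
    ∃ t : ℝ, 0 ≤ t ∧ 0 ≤ σ - t • τ ∧ support (σ - t • τ) < support σ := by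
  set A : Set ℝ := {t | 0 ≤ t ∧ t • τ ≤ σ} with hA
  have htr := trace_pos hτ hτ0
  have hne : A.Nonempty := ⟨0, le_rfl, by simpa using hσ⟩
  have hbdd : BddAbove A := by
    refine ⟨σ.trace.re / τ.trace.re, fun t ht => ?_⟩
    rw [le_div_iff₀ htr]
    simpa [Matrix.trace_smul] using trace_mono ht.2
  have hcl : IsClosed {t : ℝ | t • τ ≤ σ} := isClosed_le (by fun_prop) (by fun_prop)
  have hclosed : IsClosed A :=
    (isClosed_le continuous_const continuous_id).inter hcl
  have hmem := hclosed.csSup_mem hne hbdd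
  set t := sSup A
  have hle : σ - t • τ ≤ σ := sub_le_self _ (smul_nonneg hmem.1 hτ)
  have h0 : 0 ≤ σ - t • τ := sub_nonneg.2 hmem.2
  refine ⟨t, hmem.1, h0, lt_of_le_of_ne (support_le_of_le h0 hle) fun heq => ?_⟩
  obtain ⟨C, hC, hle⟩ := exists_le_smul_of_support_le h0 hτ (h.trans heq.ge)
  have : t + C⁻¹ ∈ A := by
    refine ⟨by have := hmem.1; positivity, ?_⟩
    have := smul_le_smul_of_nonneg_left hle (inv_pos.2 hC).le
    rw [smul_smul, inv_mul_cancel₀ hC.ne', one_smul, le_sub_iff_add_le] at this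
    rwa [add_comm, add_smul]
  have := le_csSup hbdd this
  have := inv_pos.2 hC
  linarith

end MatrixOrder

/-! ### Invariant states and decomposition into minimal ones -/

section InvariantStates

open scoped Matrix.Norms.L2Operator MatrixOrder

variable {n Y L : Type*} [Fintype n] [DecidableEq n] [Fintype Y] [Fintype L]
  {V : Y → L → Matrix n n ℂ}

omit [DecidableEq n] [Fintype Y] in
lemma krausOp_add (y : Y) (ρ σ : Matrix n n ℂ) :
    krausOp V y (ρ + σ) = krausOp V y ρ + krausOp V y σ := by
  simp [krausOp, mul_add, add_mul, Finset.sum_add_distrib]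

omit [DecidableEq n] [Fintype Y] in
lemma krausOp_smul {R : Type*} [Monoid R] [DistribMulAction R ℂ] [IsScalarTower R ℂ ℂ]
    [SMulCommClass R ℂ ℂ] (y : Y) (c : R) (ρ : Matrix n n ℂ) :
    krausOp V y (c • ρ) = c • krausOp V y ρ := by
  simp [krausOp, Finset.smul_sum, Matrix.mul_smul, Matrix.smul_mul]

omit [DecidableEq n] [Fintype Y] in
lemma krausOp_nonneg (y : Y) {ρ : Matrix n n ℂ} (hρ : 0 ≤ ρ) : 0 ≤ krausOp V y ρ :=
  (Matrix.posSemidef_sum _ fun _ _ => (Matrix.nonneg_iff_posSemidef.1 hρ).mul_mul_conjTranspose_same _).nonneg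

omit [DecidableEq n] [Fintype Y] in
lemma krausOp_mono (y : Y) {ρ σ : Matrix n n ℂ} (h : ρ ≤ σ) : krausOp V y ρ ≤ krausOp V y σ := by
  have := krausOp_nonneg (V := V) y (sub_nonneg.2 h)
  rwa [← sub_add_cancel σ ρ, krausOp_add, le_add_iff_nonneg_left]

omit [DecidableEq n] in
lemma channel_add (ρ σ : Matrix n n ℂ) : channel V (ρ + σ) = channel V ρ + channel V σ := by
  simp [channel, krausOp_add, Finset.sum_add_distrib]

omit [DecidableEq n] in
lemma channel_smul {R : Type*} [Monoid R] [DistribMulAction R ℂ] [IsScalarTower R ℂ ℂ]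
    [SMulCommClass R ℂ ℂ] (c : R) (ρ : Matrix n n ℂ) : channel V (c • ρ) = c • channel V ρ := by
  simp [channel, krausOp_smul, Finset.smul_sum]

omit [DecidableEq n] in
lemma channel_sub (ρ σ : Matrix n n ℂ) : channel V (ρ - σ) = channel V ρ - channel V σ := by
  rw [eq_sub_iff_add_eq, ← channel_add, sub_add_cancel]

omit [DecidableEq n] in
lemma channel_nonneg {ρ : Matrix n n ℂ} (hρ : 0 ≤ ρ) : 0 ≤ channel V ρ :=
  Finset.sum_nonneg fun y _ => krausOp_nonneg y hρ

omit [DecidableEq n] in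
lemma channel_mono {ρ σ : Matrix n n ℂ} (h : ρ ≤ σ) : channel V ρ ≤ channel V σ :=
  Finset.sum_le_sum fun y _ => krausOp_mono y h

omit [DecidableEq n] in
lemma krausOp_le_channel (y : Y) {ρ : Matrix n n ℂ} (hρ : 0 ≤ ρ) :
    krausOp V y ρ ≤ channel V ρ :=
  Finset.single_le_sum (f := fun y => krausOp V y ρ) (fun y _ => krausOp_nonneg y hρ)
    (Finset.mem_univ y)

lemma trace_channel (hV : IsKraus V) (ρ : Matrix n n ℂ) : (channel V ρ).trace = ρ.trace := by
  rw [channel, Matrix.trace_sum, sum_trace_krausOp hV]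

omit [DecidableEq n] in
lemma continuous_channel : Continuous (channel V) := by
  unfold channel krausOp
  fun_prop

omit [DecidableEq n] in
lemma trace_eq_ofReal {ρ : Matrix n n ℂ} (hρ : 0 ≤ ρ) : ρ.trace = (ρ.trace.re : ℂ) :=
  Complex.ext rfl (Complex.le_def.1 (Matrix.nonneg_iff_posSemidef.1 hρ).trace_nonneg).2.symm

omit [DecidableEq n] in
lemma trace_re_nonneg {ρ : Matrix n n ℂ} (hρ : 0 ≤ ρ) : 0 ≤ ρ.trace.re :=
  (Complex.le_def.1 (Matrix.nonneg_iff_posSemidef.1 hρ).trace_nonneg).1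

lemma isState_normalized {ρ : Matrix n n ℂ} (hρ : 0 ≤ ρ) (h0 : ρ ≠ 0) :
    IsState (ρ.trace.re⁻¹ • ρ) := by
  have htr := trace_pos hρ h0
  refine ⟨Matrix.nonneg_iff_posSemidef.1 (smul_nonneg (inv_pos.2 htr).le hρ), ?_⟩
  rw [Matrix.trace_smul, trace_eq_ofReal hρ, Complex.real_smul, ← Complex.ofReal_mul,
    Complex.ofReal_re, inv_mul_cancel₀ htr.ne', Complex.ofReal_one]

lemma isInvariantState_normalized {ρ : Matrix n n ℂ} (hρ : 0 ≤ ρ) (h0 : ρ ≠ 0)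
    (hinv : channel V ρ = ρ) : IsInvariantState V (ρ.trace.re⁻¹ • ρ) :=
  ⟨isState_normalized hρ h0, by rw [channel_smul, hinv]⟩

lemma support_real_smul {t : ℝ} (ht : t ≠ 0) (ρ : Matrix n n ℂ) : support (t • ρ) = support ρ := by
  rw [← support_smul (Complex.ofReal_ne_zero.2 ht) ρ]
  congr 1

lemma support_real_smul_le (t : ℝ) (ρ : Matrix n n ℂ) : support (t • ρ) ≤ support ρ :=
  support_smul_le (t : ℂ) ρ

lemma IsMinimalInvariantState.nonneg {τ : Matrix n n ℂ} (h : IsMinimalInvariantState V τ) :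
    0 ≤ τ := h.1.1.1.nonneg

lemma IsMinimalInvariantState.trace_eq_one {τ : Matrix n n ℂ} (h : IsMinimalInvariantState V τ) :
    τ.trace = 1 := h.1.1.2

lemma IsMinimalInvariantState.ne_zero {τ : Matrix n n ℂ} (h : IsMinimalInvariantState V τ) :
    τ ≠ 0 := by
  rintro rfl
  simpa using h.trace_eq_one

lemma exists_isMinimalInvariantState {ρ : Matrix n n ℂ} (hρ : 0 ≤ ρ) (h0 : ρ ≠ 0)
    (hinv : channel V ρ = ρ) : ∃ τ, IsMinimalInvariantState V τ ∧ support τ ≤ support ρ := by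
  let S : Set (Submodule ℂ (EuclideanSpace ℂ n)) :=
    {W | ∃ τ, IsInvariantState V τ ∧ support τ = W ∧ W ≤ support ρ}
  have hS : S.Nonempty := ⟨support ρ, _, isInvariantState_normalized hρ h0 hinv,
    support_real_smul (inv_pos.2 (trace_pos hρ h0)).ne' ρ, le_rfl⟩
  obtain ⟨W, ⟨τ, hτ, rfl, hle⟩, hmin⟩ := WellFounded.has_min wellFounded_lt S hS
  exact ⟨τ, ⟨hτ, fun σ hσ hlt => hmin _ ⟨σ, hσ, rfl, hlt.le.trans hle⟩ hlt⟩, hle⟩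

/-- Every positive invariant matrix is a nonnegative combination of minimal invariant states. -/
lemma invariant_induction {motive : Matrix n n ℂ → Prop} (zero : motive 0)
    (add : ∀ ρ τ (t : ℝ), 0 ≤ ρ → IsMinimalInvariantState V τ → 0 ≤ t → motive ρ →
      motive (ρ + t • τ))
    {ρ : Matrix n n ℂ} (hρ : 0 ≤ ρ) (hinv : channel V ρ = ρ) : motive ρ := by
  induction hW : support ρ using WellFoundedLT.induction generalizing ρ with
  | ind W ih =>
    subst hW
    by_cases h0 : ρ = 0
    · rwa [h0]
    obtain ⟨τ, hτ, hle⟩ := exists_isMinimalInvariantState hρ h0 hinv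
    -- Removing the largest possible multiple of τ leaves a positive invariant matrix of strictly
    -- smaller support, to which the induction applies.
    obtain ⟨t, ht, hpos, hlt⟩ := exists_sub_smul_support_lt hρ hτ.nonneg hτ.ne_zero hle
    rw [← sub_add_cancel ρ (t • τ)]
    refine add _ _ _ hpos hτ ht (ih _ hlt hpos ?_ rfl)
    rw [channel_sub, channel_smul, hinv, hτ.1.2]

lemma minimalSpan_eq_top (h : IsFaithful V) : minimalSpan V = ⊤ := by
  obtain ⟨ρ, hρ, hfull⟩ := h
  have key : support ρ ≤ minimalSpan V := by
    refine invariant_induction (motive := fun ρ => support ρ ≤ minimalSpan V) ?_ ?_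
      hρ.1.1.nonneg hρ.2
    · intro v hv
      obtain ⟨u, hu⟩ := mem_support_iff.1 hv
      have : v = 0 := by
        ext i
        simp [← hu]
      rw [this]
      exact zero_mem _
    · intro ρ τ t _ hτ _ ih
      refine (support_add_le _ _).trans (sup_le ih ((support_real_smul_le t τ).trans ?_))
      exact le_iSup₂_of_le (f := fun ρ (_ : ρ ∈ {ρ | IsMinimalInvariantState V ρ}) => support ρ)
        τ hτ le_rfl
  exact eq_top_iff.2 (support_eq_top hfull ▸ key)

lemma minimalProjector_eq_one (h : IsFaithful V) : minimalProjector V = 1 := by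
  simp only [minimalProjector, minimalSpan_eq_top h]
  apply Matrix.toEuclideanLin.injective
  rw [LinearEquiv.apply_symm_apply]
  ext v i
  simp [Submodule.starProjection_eq_self_iff.2 (Submodule.mem_top (x := v))]

/-- Subtracting the largest multiple of τ from σ leaves a positive invariant matrix whose support is
strictly inside that of τ; by minimality it vanishes. The factor is then read off from the trace. -/
lemma IsMinimalInvariantState.eq_trace_smul {τ σ : Matrix n n ℂ}
    (hτ : IsMinimalInvariantState V τ) (hσ : 0 ≤ σ) (hinv : channel V σ = σ)
    (hle : support σ ≤ support τ) : σ = σ.trace.re • τ := by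
  by_cases h0 : σ = 0
  · simp [h0]
  have htr := trace_pos hσ h0
  have heq : support σ = support τ := by
    by_contra hne
    refine hτ.2 _ (isInvariantState_normalized hσ h0 hinv) ?_
    rw [support_real_smul (inv_pos.2 htr).ne']
    exact lt_of_le_of_ne hle hne
  obtain ⟨t, ht, hpos, hlt⟩ := exists_sub_smul_support_lt hσ hτ.nonneg hτ.ne_zero heq.ge
  have hz : σ - t • τ = 0 := by
    by_contra hne
    have hi : channel V (σ - t • τ) = σ - t • τ := by
      rw [channel_sub, channel_smul, hinv, hτ.1.2]
    refine hτ.2 _ (isInvariantState_normalized hpos hne hi) ?_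
    rw [support_real_smul (inv_pos.2 (trace_pos hpos hne)).ne', ← heq]
    exact hlt
  have hst := sub_eq_zero.1 hz
  rw [hst]
  simp [Matrix.trace_smul, hτ.trace_eq_one]

/-- The average of the first `N + 1` iterates of the channel. -/
def cesaro (V : Y → L → Matrix n n ℂ) (ρ : Matrix n n ℂ) (N : ℕ) : Matrix n n ℂ :=
  ((N + 1 : ℕ) : ℝ)⁻¹ • ∑ k ∈ Finset.range (N + 1), (channel V)^[k] ρ

omit [DecidableEq n] in
lemma channel_sum {ι : Type*} (s : Finset ι) (f : ι → Matrix n n ℂ) :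
    channel V (∑ i ∈ s, f i) = ∑ i ∈ s, channel V (f i) :=
  map_sum (AddMonoidHom.mk' (channel V) channel_add) f s

/-- Below a minimal invariant state `τ`, the averages of the iterates of the channel accumulate at a
multiple of `τ`. -/
lemma IsMinimalInvariantState.tendsto_cesaro {τ ρ : Matrix n n ℂ} (hV : IsKraus V)
    (hτ : IsMinimalInvariantState V τ) (hρ : 0 ≤ ρ) (hle : ρ ≤ τ) :
    ∃ φ : ℕ → ℕ, StrictMono φ ∧
      Tendsto (fun k => cesaro V ρ (φ k)) atTop (𝓝 (ρ.trace.re • τ)) := by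
  have hiter : ∀ k, 0 ≤ (channel V)^[k] ρ ∧ (channel V)^[k] ρ ≤ τ ∧
      ((channel V)^[k] ρ).trace = ρ.trace := by
    intro k
    induction k with
    | zero => exact ⟨hρ, hle, rfl⟩
    | succ k ih =>
      rw [Function.iterate_succ_apply']
      exact ⟨channel_nonneg ih.1, hτ.1.2 ▸ channel_mono ih.2.1, by rw [trace_channel hV, ih.2.2]⟩
  have hN : ∀ N : ℕ, ((N + 1 : ℕ) : ℝ) ≠ 0 := fun N => by positivity
  have hmem : ∀ N, cesaro V ρ N ∈ Set.Icc 0 τ := by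
    intro N
    refine ⟨smul_nonneg (by positivity) (Finset.sum_nonneg fun k _ => (hiter k).1), ?_⟩
    calc cesaro V ρ N ≤ ((N + 1 : ℕ) : ℝ)⁻¹ • ∑ k ∈ Finset.range (N + 1), τ :=
          smul_le_smul_of_nonneg_left (Finset.sum_le_sum fun k _ => (hiter k).2.1) (by positivity)
      _ = τ := by
        rw [Finset.sum_const, Finset.card_range, ← Nat.cast_smul_eq_nsmul ℝ, smul_smul,
          inv_mul_cancel₀ (hN N), one_smul]
  have htrace : ∀ N, (cesaro V ρ N).trace.re = ρ.trace.re := by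
    intro N
    rw [cesaro, Matrix.trace_smul, Matrix.trace_sum, Finset.sum_congr rfl fun k _ => (hiter k).2.2,
      Finset.sum_const, Finset.card_range, ← Nat.cast_smul_eq_nsmul ℝ, smul_smul,
      inv_mul_cancel₀ (hN N), one_smul]
  have hcomp : IsCompact (Set.Icc 0 τ) := by
    refine Metric.isCompact_of_isClosed_isBounded isClosed_Icc ?_
    refine (Metric.isBounded_closedBall (x := (0 : Matrix n n ℂ)) (r := ‖τ‖)).subset fun X hX => ?_
    rw [mem_closedBall_zero_iff]
    exact CStarAlgebra.norm_le_norm_of_nonneg_of_le hX.1 hX.2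
  obtain ⟨σ, hσ, φ, hφ, hlim⟩ := hcomp.tendsto_subseq hmem
  refine ⟨φ, hφ, ?_⟩
  -- The sum telescopes. Both remaining terms lie between 0 and τ, so the difference is O(1/N) and
  -- every limit point of the averages is invariant.
  have hdiff : ∀ N, channel V (cesaro V ρ N) - cesaro V ρ N =
      ((N + 1 : ℕ) : ℝ)⁻¹ • ((channel V)^[N + 1] ρ - ρ) := by
    intro N
    rw [cesaro, channel_smul, channel_sum, ← smul_sub]
    congr 1
    simp only [← Function.iterate_succ_apply' (channel V)]
    rw [← Finset.sum_sub_distrib, Finset.sum_range_sub (fun k => (channel V)^[k] ρ)]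
    rfl
  have hinv : channel V σ = σ := by
    have h1 : Tendsto (fun k => channel V (cesaro V ρ (φ k)) - cesaro V ρ (φ k)) atTop
        (𝓝 (channel V σ - σ)) :=
      ((continuous_channel.tendsto σ).comp hlim).sub hlim
    have h2 : Tendsto (fun N => channel V (cesaro V ρ N) - cesaro V ρ N) atTop (𝓝 0) := by
      refine squeeze_zero_norm (a := fun N : ℕ => 2 * ‖τ‖ * ((N + 1 : ℕ) : ℝ)⁻¹) (fun N => ?_) ?_
      · rw [hdiff, norm_smul, mul_comm]
        rw [Real.norm_of_nonneg (by positivity)]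
        gcongr
        refine (norm_sub_le _ _).trans ?_
        have h1 := CStarAlgebra.norm_le_norm_of_nonneg_of_le (hiter (N + 1)).1 (hiter (N + 1)).2.1
        have h2 := CStarAlgebra.norm_le_norm_of_nonneg_of_le hρ hle
        linarith
      · have := (tendsto_inv_atTop_nhds_zero_nat (𝕜 := ℝ)).comp (tendsto_add_atTop_nat 1)
        simpa using this.const_mul (2 * ‖τ‖)
    exact sub_eq_zero.1 (tendsto_nhds_unique h1 (h2.comp hφ.tendsto_atTop))
  have htr : σ.trace.re = ρ.trace.re := by
    have hc : Continuous fun X : Matrix n n ℂ => X.trace.re :=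
      Complex.continuous_re.comp (Continuous.matrix_trace continuous_id)
    refine tendsto_nhds_unique ((hc.tendsto σ).comp hlim) ?_
    simp only [Function.comp_def, htrace]
    exact tendsto_const_nhds
  -- The limit point is invariant, lies below τ and keeps the trace of ρ, so uniqueness below a
  -- minimal state identifies it.
  rw [← htr, ← hτ.eq_trace_smul hσ.1 hinv (support_le_of_le hσ.1 hσ.2)]
  exact hlim

omit [DecidableEq n] [Fintype Y] in
lemma unnormalized_smul {R : Type*} [Monoid R] [DistribMulAction R ℂ] [IsScalarTower R ℂ ℂ]
    [SMulCommClass R ℂ ℂ] (c : R) (ρ : Matrix n n ℂ) (ω : ℕ → Y) (k : ℕ) :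
    unnormalized V (c • ρ) ω k = c • unnormalized V ρ ω k := by
  induction k with
  | zero => rfl
  | succ k ih => simp only [unnormalized, ih, krausOp_smul]

omit [DecidableEq n] [Fintype Y] in
lemma unnormalized_add (ρ σ : Matrix n n ℂ) (ω : ℕ → Y) (k : ℕ) :
    unnormalized V (ρ + σ) ω k = unnormalized V ρ ω k + unnormalized V σ ω k := by
  induction k with
  | zero => rfl
  | succ k ih => simp only [unnormalized, ih, krausOp_add]

omit [DecidableEq n] [Fintype Y] in
lemma unnormalized_nonneg {ρ : Matrix n n ℂ} (hρ : 0 ≤ ρ) (ω : ℕ → Y) (k : ℕ) :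
    0 ≤ unnormalized V ρ ω k := by
  induction k with
  | zero => exact hρ
  | succ k ih => exact krausOp_nonneg _ ih

/-- Each step applies K_y ≤ Φ, and Φ fixes τ. This makes the unnormalised states along a record
admissible in `tendsto_cesaro`. -/
lemma IsMinimalInvariantState.unnormalized_le {τ : Matrix n n ℂ}
    (hτ : IsMinimalInvariantState V τ) (ω : ℕ → Y) (k : ℕ) : unnormalized V τ ω k ≤ τ := by
  induction k with
  | zero => exact le_rfl
  | succ k ih =>
    calc krausOp V (ω k) (unnormalized V τ ω k)
        ≤ krausOp V (ω k) τ := krausOp_mono _ ih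
      _ ≤ channel V τ := krausOp_le_channel _ hτ.nonneg
      _ = τ := hτ.1.2

end InvariantStates

/-! ### Cylinders and the shift -/

section Records

variable {Y : Type*} [Fintype Y] [MeasurableSpace Y] [MeasurableSingletonClass Y]

omit [Fintype Y] in
lemma measurableSet_cyl (ω : ℕ → Y) (k : ℕ) : MeasurableSet (cyl ω k) := by
  have : cyl ω k = ⋂ i ∈ Finset.range k, (fun ω' => ω' i) ⁻¹' {ω i} := by
    ext ω'
    simp [cyl]
  rw [this]
  exact Finset.measurableSet_biInter _ fun i _ => measurable_pi_apply i (measurableSet_singleton _)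

/-- Cylinders of length k + 1 give the point masses of the marginal on times 0, …, k, which lives on
a finite set; these marginals determine a finite measure. -/
lemma measure_ext_of_cyl {P Q : Measure (ℕ → Y)} [IsFiniteMeasure P] [IsFiniteMeasure Q]
    (h : ∀ ω k, P (cyl ω k) = Q (cyl ω k)) : P = Q := by
  have hproj : IsProjectiveLimit P (fun I : Finset ℕ => Q.map I.restrict) := by
    rw [isProjectiveLimit_nat_iff fun I J hJI => by
      change Q.map J.restrict = (Q.map I.restrict).map _
      rw [Measure.map_map (by fun_prop) (by fun_prop)]
      rfl]
    intro k
    refine Measure.ext_of_singleton fun x => ?_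
    have ms : MeasurableSet ({x} : Set (Finset.Iic k → Y)) := MeasurableSet.singleton _
    obtain ⟨ω, rfl⟩ : ∃ ω : ℕ → Y, x = Preorder.frestrictLe (π := fun _ => Y) k ω := by
      refine ⟨fun i => if hi : i ∈ Finset.Iic k then x ⟨i, hi⟩ else x ⟨0, by simp⟩, ?_⟩
      ext ⟨i, hi⟩
      have hi' : i ≤ k := by simpa using hi
      simp [hi']
    have hset : cyl ω (k + 1) =
        (Preorder.frestrictLe (π := fun _ => Y) k) ⁻¹' {Preorder.frestrictLe k ω} := by
      ext ω'
      simp [cyl, funext_iff]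
    rw [Measure.map_apply (by fun_prop) ms]
    change _ = Q.map (Preorder.frestrictLe (π := fun _ => Y) k) _
    rw [Measure.map_apply (by fun_prop) ms, ← hset, h]
  have hfin : ∀ I : Finset ℕ, IsFiniteMeasure (Q.map (I.restrict (π := fun _ => Y))) :=
    fun I => inferInstance
  exact hproj.unique fun I => rfl

/-- The shift of a record. -/
def shift (ω : ℕ → Y) : ℕ → Y := fun i => ω (i + 1)

/-- The record that starts with `y` and goes on as `ω`. -/
def prepend (y : Y) (ω : ℕ → Y) : ℕ → Y
  | 0 => y
  | i + 1 => ω i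

omit [Fintype Y] [MeasurableSingletonClass Y] in
lemma measurable_shift : Measurable (shift (Y := Y)) :=
  measurable_pi_lambda _ fun i => measurable_pi_apply (i + 1)

omit [Fintype Y] [MeasurableSpace Y] [MeasurableSingletonClass Y] in
lemma cyl_succ (ω : ℕ → Y) (k : ℕ) :
    cyl ω (k + 1) = (fun ω' => ω' 0) ⁻¹' {ω 0} ∩ shift ⁻¹' cyl (shift ω) k := by
  ext ω'
  simp only [cyl, shift, Set.mem_ofPred_eq, Set.mem_inter_iff, Set.mem_preimage,
    Set.mem_singleton_iff]
  refine ⟨fun h => ⟨h 0 (by omega), fun i hi => h (i + 1) (by omega)⟩, fun h i hi => ?_⟩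
  cases i with
  | zero => exact h.1
  | succ i => exact h.2 i (by omega)

end Records

/-! ### Laws of positive matrices, the Markov property and ergodicity -/

section LawOfPositive

open scoped Matrix.Norms.L2Operator MatrixOrder

variable {n Y L : Type*} [Fintype n] [DecidableEq n] [Fintype Y] [Fintype L] [MeasurableSpace Y]
  {V : Y → L → Matrix n n ℂ}

instance isFiniteMeasure_outputLaw (V : Y → L → Matrix n n ℂ) (ρ : Matrix n n ℂ) :
    IsFiniteMeasure (outputLaw V ρ) := by
  unfold outputLaw
  split_ifs with h
  · have := h.choose_spec.1
    infer_instance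
  · infer_instance

/-- The finite measure on records generated by a positive matrix. -/
def law (V : Y → L → Matrix n n ℂ) (ρ : Matrix n n ℂ) : Measure (ℕ → Y) :=
  ENNReal.ofReal ρ.trace.re • outputLaw V (ρ.trace.re⁻¹ • ρ)

instance isFiniteMeasure_law (V : Y → L → Matrix n n ℂ) (ρ : Matrix n n ℂ) :
    IsFiniteMeasure (law V ρ) :=
  Measure.smul_finite _ ENNReal.ofReal_ne_top

omit [DecidableEq n] [Fintype Y] in
lemma law_eq_outputLaw {ρ : Matrix n n ℂ} (hρ : IsState ρ) : law V ρ = outputLaw V ρ := by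
  simp [law, hρ.2]

omit [DecidableEq n] [Fintype Y] [MeasurableSpace Y] in
lemma unnormalized_succ' (ρ : Matrix n n ℂ) (ω : ℕ → Y) (k : ℕ) :
    unnormalized V ρ ω (k + 1) = unnormalized V (krausOp V (ω 0) ρ) (shift ω) k := by
  induction k with
  | zero => rfl
  | succ k ih =>
    rw [unnormalized, ih]
    rfl

variable [MeasurableSingletonClass Y]

lemma law_univ (hV : IsKraus V) {ρ : Matrix n n ℂ} (hρ : 0 ≤ ρ) :
    law V ρ Set.univ = ENNReal.ofReal ρ.trace.re := by
  by_cases h0 : ρ = 0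
  · simp [law, h0]
  have := (isOutputLaw_outputLaw hV (isState_normalized hρ h0)).1
  simp [law]

lemma law_cyl (hV : IsKraus V) {ρ : Matrix n n ℂ} (hρ : 0 ≤ ρ) (ω : ℕ → Y) (k : ℕ) :
    law V ρ (cyl ω k) = ENNReal.ofReal (unnormalized V ρ ω k).trace.re := by
  by_cases h0 : ρ = 0
  · have := unnormalized_smul (V := V) (0 : ℝ) ρ ω k
    rw [zero_smul, zero_smul, ← h0] at this
    rw [this]
    simp [law, h0]
  have htr := trace_pos hρ h0
  have := (isOutputLaw_outputLaw hV (isState_normalized hρ h0)).2 ω k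
  rw [law, Measure.smul_apply, this, unnormalized_smul, smul_eq_mul, ← ENNReal.ofReal_mul htr.le,
    Matrix.trace_smul, Complex.smul_re, smul_eq_mul, mul_inv_cancel_left₀ htr.ne']

/-- Cylinder weights are additive in the matrix. This is the reason for working with `law` on the
whole positive cone instead of on normalised states. -/
lemma law_add (hV : IsKraus V) {ρ σ : Matrix n n ℂ} (hρ : 0 ≤ ρ) (hσ : 0 ≤ σ) :
    law V (ρ + σ) = law V ρ + law V σ := by
  refine measure_ext_of_cyl fun ω k => ?_
  rw [Measure.add_apply, law_cyl hV (add_nonneg hρ hσ), law_cyl hV hρ, law_cyl hV hσ,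
    ← ENNReal.ofReal_add (trace_re_nonneg (unnormalized_nonneg hρ _ _))
      (trace_re_nonneg (unnormalized_nonneg hσ _ _)), unnormalized_add, Matrix.trace_add,
    Complex.add_re]

lemma law_smul (hV : IsKraus V) {t : ℝ} (ht : 0 ≤ t) {ρ : Matrix n n ℂ} (hρ : 0 ≤ ρ) :
    law V (t • ρ) = ENNReal.ofReal t • law V ρ := by
  have : IsFiniteMeasure (ENNReal.ofReal t • law V ρ) :=
    Measure.smul_finite _ ENNReal.ofReal_ne_top
  refine measure_ext_of_cyl fun ω k => ?_
  rw [Measure.smul_apply, law_cyl hV (smul_nonneg ht hρ), law_cyl hV hρ, smul_eq_mul,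
    ← ENNReal.ofReal_mul ht, unnormalized_smul, Matrix.trace_smul, Complex.smul_re, smul_eq_mul]

omit [DecidableEq n] [Fintype Y] [MeasurableSingletonClass Y] in
lemma law_zero : law V (0 : Matrix n n ℂ) = 0 := by
  simp [law]

lemma law_sum (hV : IsKraus V) {ι : Type*} (s : Finset ι) {f : ι → Matrix n n ℂ}
    (hf : ∀ i, 0 ≤ f i) : law V (∑ i ∈ s, f i) = ∑ i ∈ s, law V (f i) := by
  classical
  induction s using Finset.induction_on with
  | empty => simp [law_zero]
  | insert i s hi ih =>
    rw [Finset.sum_insert hi, Finset.sum_insert hi,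
      law_add hV (hf i) (Finset.sum_nonneg fun j _ => hf j), ih]

lemma law_mono (hV : IsKraus V) {ρ σ : Matrix n n ℂ} (hρ : 0 ≤ ρ) (h : ρ ≤ σ) :
    law V ρ ≤ law V σ := by
  rw [← add_sub_cancel ρ σ, law_add hV hρ (sub_nonneg.2 h)]
  exact Measure.le_add_right le_rfl

lemma law_absolutelyContinuous (hV : IsKraus V) {ρ σ : Matrix n n ℂ} (hρ : 0 ≤ ρ) (hσ : 0 ≤ σ)
    (h : support ρ ≤ support σ) : law V ρ ≪ law V σ := by
  obtain ⟨C, hC, hle⟩ := exists_le_smul_of_support_le hσ hρ h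
  have := law_mono hV hρ hle
  rw [law_smul hV hC.le hσ] at this
  exact (Measure.absolutelyContinuous_of_le this).trans Measure.smul_absolutelyContinuous

/-- The Markov property: after the outcome y the record starts afresh from K_y(ρ). Both sides are
finite measures in A, so cylinders suffice. -/
lemma law_first_inter_shift (hV : IsKraus V) {ρ : Matrix n n ℂ} (hρ : 0 ≤ ρ) (y : Y)
    {A : Set (ℕ → Y)} (hA : MeasurableSet A) :
    law V ρ ((fun ω => ω 0) ⁻¹' {y} ∩ shift ⁻¹' A) = law V (krausOp V y ρ) A := by
  have hy : MeasurableSet ((fun ω : ℕ → Y => ω 0) ⁻¹' {y}) :=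
    measurable_pi_apply 0 (measurableSet_singleton y)
  have key : ((law V ρ).restrict ((fun ω => ω 0) ⁻¹' {y})).map shift =
      law V (krausOp V y ρ) := by
    refine measure_ext_of_cyl fun ω k => ?_
    rw [Measure.map_apply measurable_shift (measurableSet_cyl ω k),
      Measure.restrict_apply (measurable_shift (measurableSet_cyl ω k)), Set.inter_comm,
      law_cyl hV (krausOp_nonneg y hρ)]
    have := cyl_succ (prepend y ω) k
    rw [show (prepend y ω) 0 = y from rfl, show shift (prepend y ω) = ω from rfl] at this
    rw [← this, law_cyl hV hρ, unnormalized_succ']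
    rfl
  rw [← key, Measure.map_apply measurable_shift hA, Measure.restrict_apply (measurable_shift hA),
    Set.inter_comm]

lemma law_preimage_shift (hV : IsKraus V) {ρ : Matrix n n ℂ} (hρ : 0 ≤ ρ)
    {A : Set (ℕ → Y)} (hA : MeasurableSet A) :
    law V ρ (shift ⁻¹' A) = law V (channel V ρ) A := by
  rw [channel, law_sum hV _ fun y => krausOp_nonneg y hρ, Measure.finsetSum_apply]
  simp only [← law_first_inter_shift hV hρ _ hA]
  have hy : ∀ y, MeasurableSet ((fun ω : ℕ → Y => ω 0) ⁻¹' {y}) := fun y =>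
    measurable_pi_apply 0 (measurableSet_singleton y)
  have := sum_measure_preimage_singleton (μ := (law V ρ).restrict (shift ⁻¹' A)) Finset.univ
    (f := fun ω : ℕ → Y => ω 0) fun y _ => hy y
  simp only [Measure.restrict_apply (hy _), Finset.coe_univ, Set.preimage_univ,
    Measure.restrict_apply_univ] at this
  exact this.symm

/-- A shift-invariant event depends only on the record after time k, so the Markov property can be
iterated through the first k outcomes. -/
lemma law_inter_cyl (hV : IsKraus V) {A : Set (ℕ → Y)} (hA : MeasurableSet A)
    (hinv : shift ⁻¹' A = A) {ρ : Matrix n n ℂ} (hρ : 0 ≤ ρ) (ω : ℕ → Y) (k : ℕ) :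
    law V ρ (A ∩ cyl ω k) = law V (unnormalized V ρ ω k) A := by
  induction k generalizing ρ ω with
  | zero => simp [cyl, unnormalized]
  | succ k ih =>
    rw [unnormalized_succ', ← ih (krausOp_nonneg _ hρ),
      ← law_first_inter_shift hV hρ _ (hA.inter (measurableSet_cyl _ _)), cyl_succ,
      Set.preimage_inter, hinv, Set.inter_left_comm]

/-- Since ρ ≤ σ + ‖ρ - σ‖ 1, monotonicity of the law suffices; the error is the total mass Tr(‖ρ -
σ‖ 1). The bound does not depend on A and gives continuity of the law in the matrix. -/
lemma law_real_le_add (hV : IsKraus V) {ρ σ : Matrix n n ℂ} (hρ : 0 ≤ ρ) (hσ : 0 ≤ σ)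
    (A : Set (ℕ → Y)) :
    (law V ρ).real A ≤ (law V σ).real A + ‖ρ - σ‖ * Fintype.card n := by
  have hsa : IsSelfAdjoint (ρ - σ) := hρ.isSelfAdjoint.sub hσ.isSelfAdjoint
  have hle : ρ ≤ σ + ‖ρ - σ‖ • (1 : Matrix n n ℂ) := by
    have := hsa.le_algebraMap_norm_self
    rwa [Algebra.algebraMap_eq_smul_one, sub_le_iff_le_add'] at this
  have h1 : (0 : Matrix n n ℂ) ≤ ‖ρ - σ‖ • 1 := smul_nonneg (norm_nonneg _) zero_le_one
  have := law_mono hV hρ hle A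
  rw [law_add hV hσ h1, Measure.add_apply] at this
  have h2 : law V (‖ρ - σ‖ • (1 : Matrix n n ℂ)) A ≤
      ENNReal.ofReal (‖ρ - σ‖ * Fintype.card n) := by
    refine (measure_mono (Set.subset_univ A)).trans ?_
    rw [law_univ hV h1]
    simp [Matrix.trace_smul]
  have h3 := ENNReal.toReal_mono (by finiteness) (this.trans (add_le_add_right h2 _))
  rwa [ENNReal.toReal_add (by finiteness) (by finiteness),
    ENNReal.toReal_ofReal (by positivity)] at h3

lemma tendsto_law_real (hV : IsKraus V) {ρ : ℕ → Matrix n n ℂ} {σ : Matrix n n ℂ}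
    (hρ : ∀ k, 0 ≤ ρ k) (hσ : 0 ≤ σ) (hlim : Tendsto ρ atTop (𝓝 σ)) (A : Set (ℕ → Y)) :
    Tendsto (fun k => (law V (ρ k)).real A) atTop (𝓝 ((law V σ).real A)) := by
  rw [tendsto_iff_norm_sub_tendsto_zero] at hlim ⊢
  refine squeeze_zero (fun _ => norm_nonneg _) (fun k => ?_)
    (by simpa using hlim.mul_const (Fintype.card n : ℝ))
  rw [Real.norm_eq_abs, abs_sub_le_iff]
  have h1 := law_real_le_add hV (hρ k) hσ A
  have h2 := law_real_le_add hV hσ (hρ k) A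
  rw [norm_sub_rev] at h2
  constructor <;> linarith

lemma law_iterate (hV : IsKraus V) {A : Set (ℕ → Y)} (hA : MeasurableSet A)
    (hinv : shift ⁻¹' A = A) {ρ : Matrix n n ℂ} (hρ : 0 ≤ ρ) (k : ℕ) :
    0 ≤ (channel V)^[k] ρ ∧ law V ((channel V)^[k] ρ) A = law V ρ A := by
  induction k with
  | zero => exact ⟨hρ, rfl⟩
  | succ k ih =>
    rw [Function.iterate_succ_apply']
    exact ⟨channel_nonneg ih.1, by rw [← law_preimage_shift hV ih.1 hA, hinv, ih.2]⟩

lemma law_cesaro (hV : IsKraus V) {A : Set (ℕ → Y)} (hA : MeasurableSet A)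
    (hinv : shift ⁻¹' A = A) {ρ : Matrix n n ℂ} (hρ : 0 ≤ ρ) (N : ℕ) :
    0 ≤ cesaro V ρ N ∧ law V (cesaro V ρ N) A = law V ρ A := by
  have h := law_iterate hV hA hinv hρ
  have hs := Finset.sum_nonneg fun k (_ : k ∈ Finset.range (N + 1)) => (h k).1
  refine ⟨smul_nonneg (by positivity) hs, ?_⟩
  rw [cesaro, law_smul hV (by positivity) hs, law_sum hV _ fun k => (h k).1, Measure.smul_apply,
    Measure.finsetSum_apply, Finset.sum_congr rfl fun k _ => (h k).2, Finset.sum_const,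
    Finset.card_range, smul_eq_mul, nsmul_eq_mul, ← mul_assoc,
    ENNReal.ofReal_inv_of_pos (by positivity), ENNReal.ofReal_natCast,
    ENNReal.inv_mul_cancel (by simp) (ENNReal.natCast_ne_top _), one_mul]

/-- Shift-invariant events have the same probability for all states below a minimal invariant
state. -/
lemma IsMinimalInvariantState.law_invariant (hV : IsKraus V) {A : Set (ℕ → Y)}
    (hA : MeasurableSet A) (hinv : shift ⁻¹' A = A) {ρ τ : Matrix n n ℂ}
    (hτ : IsMinimalInvariantState V τ) (hρ : 0 ≤ ρ) (hle : ρ ≤ τ) :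
    law V ρ A = ENNReal.ofReal ρ.trace.re * law V τ A := by
  -- The mass of A is constant along the averages, so its value can be computed at their
  -- subsequential limit Tr(ρ) τ.
  obtain ⟨φ, -, hlim⟩ := hτ.tendsto_cesaro hV hρ hle
  have htr := trace_re_nonneg hρ
  have h := tendsto_law_real hV (fun k => (law_cesaro hV hA hinv hρ (φ k)).1)
    (smul_nonneg htr hτ.nonneg) hlim A
  simp only [Measure.real, (law_cesaro hV hA hinv hρ _).2] at h
  have := tendsto_nhds_unique tendsto_const_nhds h
  rw [ENNReal.toReal_eq_toReal_iff' (by finiteness) (by finiteness)] at this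
  rw [this, law_smul hV htr hτ.nonneg, Measure.smul_apply, smul_eq_mul]

lemma measurePreserving_shift_law (hV : IsKraus V) {ρ : Matrix n n ℂ} (hρ : 0 ≤ ρ)
    (hinv : channel V ρ = ρ) : MeasurePreserving shift (law V ρ) (law V ρ) := by
  refine ⟨measurable_shift, Measure.ext fun A hA => ?_⟩
  rw [Measure.map_apply measurable_shift hA, law_preimage_shift hV hρ hA, hinv]

lemma IsMinimalInvariantState.ergodic (hV : IsKraus V) {τ : Matrix n n ℂ}
    (hτ : IsMinimalInvariantState V τ) : Ergodic shift (law V τ) := by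
  refine ⟨measurePreserving_shift_law hV hτ.nonneg hτ.1.2, ⟨fun A hA hinv => ?_⟩⟩
  -- A is independent of every cylinder, hence of every event; evaluating at the complement of A
  -- gives P(A) P(Aᶜ) = 0.
  have key : (law V τ).restrict A = law V τ A • law V τ := by
    have : IsFiniteMeasure (law V τ A • law V τ) := Measure.smul_finite _ (by finiteness)
    refine measure_ext_of_cyl fun ω k => ?_
    have h0 := unnormalized_nonneg (V := V) hτ.nonneg ω k
    rw [Measure.restrict_apply (measurableSet_cyl ω k), Set.inter_comm,
      law_inter_cyl hV hA hinv hτ.nonneg,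
      hτ.law_invariant hV hA hinv h0 (hτ.unnormalized_le ω k), Measure.smul_apply,
      law_cyl hV hτ.nonneg, smul_eq_mul, mul_comm]
  have hc := congrArg (fun m => m Aᶜ) key
  simp only [Measure.restrict_apply hA.compl, Set.compl_inter_self, measure_empty,
    Measure.smul_apply, smul_eq_mul] at hc
  rw [Filter.eventuallyConst_set']
  rcases mul_eq_zero.1 hc.symm with h | h
  · exact Or.inl (ae_eq_empty.2 h)
  · exact Or.inr (ae_eq_univ.2 h)

end LawOfPositive

/-! ### Singularity of distinct ergodic measures -/

section Singularity

/-- The absolutely continuous part of μ with respect to ν is invariant, so by ergodicity of ν it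
equals cν. If c = 0, μ is singular to ν; otherwise ν ≪ μ, and ergodicity of μ forces ν = μ. -/
lemma mutuallySingular_of_ergodic {Ω : Type*} [MeasurableSpace Ω] {f : Ω → Ω} {μ ν : Measure Ω}
    [IsProbabilityMeasure μ] [IsProbabilityMeasure ν] (hμ : Ergodic f μ) (hν : Ergodic f ν)
    (hne : μ ≠ ν) : μ ⟂ₘ ν := by
  have hac := hμ.toMeasurePreserving.withDensity_rnDeriv hν.toMeasurePreserving
  obtain ⟨c, hc⟩ := hν.eq_smul_of_absolutelyContinuous hac (withDensity_absolutelyContinuous _ _)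
  have hdec := μ.rnDeriv_add_singularPart ν
  rw [hc] at hdec
  rcases eq_or_ne c 0 with rfl | hc0
  · rw [zero_smul, zero_add] at hdec
    exact hdec ▸ μ.mutuallySingular_singularPart ν
  · refine absurd (hμ.eq_of_absolutelyContinuous hν.toMeasurePreserving ?_).symm hne
    rw [← hdec]
    exact (Measure.absolutelyContinuous_smul hc0).add_right _

end Singularity

/-! ### Singularity of the laws of distinct parameters -/

section SingularLaws

open scoped Matrix.Norms.L2Operator MatrixOrder

variable {Θ n Y L : Type*} [Fintype n] [DecidableEq n] [Fintype Y] [Fintype L] [MeasurableSpace Y]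
  [MeasurableSingletonClass Y] {V : Θ → Y → L → Matrix n n ℂ}

lemma IsMinimalInvariantState.isProbabilityMeasure_law {V : Y → L → Matrix n n ℂ} (hV : IsKraus V)
    {τ : Matrix n n ℂ} (hτ : IsMinimalInvariantState V τ) : IsProbabilityMeasure (law V τ) := by
  rw [law_eq_outputLaw hτ.1.1]
  exact (isOutputLaw_outputLaw hV hτ.1.1).1

lemma Identifiable.mutuallySingular_minimal (hV : ∀ p, IsKraus (V p)) (hID : Identifiable V)
    {p q : Θ} (hpq : p ≠ q) {σ τ : Matrix n n ℂ} (hσ : IsMinimalInvariantState (V p) σ)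
    (hτ : IsMinimalInvariantState (V q) τ) : law (V p) σ ⟂ₘ law (V q) τ := by
  have := hσ.isProbabilityMeasure_law (hV p)
  have := hτ.isProbabilityMeasure_law (hV q)
  refine mutuallySingular_of_ergodic (hσ.ergodic (hV p)) (hτ.ergodic (hV q)) ?_
  rw [law_eq_outputLaw hσ.1.1, law_eq_outputLaw hτ.1.1]
  exact hID p q hpq σ τ hσ hτ

lemma Identifiable.mutuallySingular_invariant (hV : ∀ p, IsKraus (V p)) (hID : Identifiable V)
    {p q : Θ} (hpq : p ≠ q) {σ τ : Matrix n n ℂ} (hσ : 0 ≤ σ) (hσi : channel (V p) σ = σ)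
    (hτ : 0 ≤ τ) (hτi : channel (V q) τ = τ) : law (V p) σ ⟂ₘ law (V q) τ := by
  refine invariant_induction (V := V p) (motive := fun σ => law (V p) σ ⟂ₘ law (V q) τ)
    ?_ ?_ hσ hσi
  · rw [law_zero]
    exact Measure.MutuallySingular.zero_left
  intro ρ σ' t hρ hσ' ht ih
  rw [law_add (hV p) hρ (smul_nonneg ht hσ'.nonneg), law_smul (hV p) ht hσ'.nonneg]
  refine ih.add_left (Measure.MutuallySingular.smul _ ?_)
  refine invariant_induction (V := V q) (motive := fun τ => law (V p) σ' ⟂ₘ law (V q) τ)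
    ?_ ?_ hτ hτi
  · rw [law_zero]
    exact Measure.MutuallySingular.zero_right
  intro ρ τ' t hρ hτ' ht ih
  rw [law_add (hV q) hρ (smul_nonneg ht hτ'.nonneg), law_smul (hV q) ht hτ'.nonneg]
  exact ih.add_right
    ((hID.mutuallySingular_minimal hV hpq hσ' hτ').symm.smul _).symm

lemma Identifiable.mutuallySingular (hV : ∀ p, IsKraus (V p)) (hID : Identifiable V)
    (hf : ∀ p, IsFaithful (V p)) {p q : Θ} (hpq : p ≠ q) {σ τ : Matrix n n ℂ} (hσ : 0 ≤ σ)
    (hτ : 0 ≤ τ) : law (V p) σ ⟂ₘ law (V q) τ := by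
  obtain ⟨ρ, hρ, hρf⟩ := hf p
  obtain ⟨ρ', hρ', hρf'⟩ := hf q
  have h0 := hρ.1.1.nonneg
  have h0' := hρ'.1.1.nonneg
  refine (hID.mutuallySingular_invariant hV hpq h0 hρ.2 h0' hρ'.2).mono_ac ?_ ?_
  · exact law_absolutelyContinuous (hV p) hσ h0 (support_eq_top hρf ▸ le_top)
  · exact law_absolutelyContinuous (hV q) hτ h0' (support_eq_top hρf' ▸ le_top)

end SingularLaws

/-! ### Likelihood ratios of singular laws -/

section LikelihoodRatio

/-- For a variable with finitely many values, conditional expectation is the elementary conditional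
probability on each fibre. Null fibres get 0/0 = 0, which does not affect the integrals. -/
lemma condExp_indicator_comap_ae_eq {Ω β : Type*} [MeasurableSpace Ω] [MeasurableSpace β]
    [Finite β] [MeasurableSingletonClass β] {ν : Measure Ω} [IsFiniteMeasure ν] {X : Ω → β}
    (hX : Measurable X) {s : Set Ω} (hs : MeasurableSet s) :
    (fun ω => ν.real (s ∩ X ⁻¹' {X ω}) / ν.real (X ⁻¹' {X ω})) =ᵐ[ν]
      ν[s.indicator (fun _ => (1 : ℝ)) | MeasurableSpace.comap X inferInstance] := by
  classical
  have := Fintype.ofFinite β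
  set G : β → ℝ := fun x => ν.real (s ∩ X ⁻¹' {x}) / ν.real (X ⁻¹' {x}) with hG
  have hGm : Measurable G := Measurable.of_discrete
  have hGi : Integrable G (ν.map X) := Integrable.of_finite
  have hGX : Integrable (fun ω => G (X ω)) ν := hGi.comp_measurable hX
  change (fun ω => G (X ω)) =ᵐ[ν] _
  refine ae_eq_condExp_of_forall_setIntegral_eq hX.comap_le
    ((integrable_const _).indicator hs) (fun _ _ _ => hGX.integrableOn) ?_ ?_
  · rintro _ ⟨T, hT, rfl⟩ -
    have h1 : ∫ ω in X ⁻¹' T, G (X ω) ∂ν = ∑ x ∈ T.toFinset, ν.real (s ∩ X ⁻¹' {x}) := by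
      rw [← setIntegral_map hT hGm.aestronglyMeasurable hX.aemeasurable, ← Set.coe_toFinset T,
        setIntegral_finset _ hGi.integrableOn]
      simp only [smul_eq_mul, Finset.toFinset_coe]
      refine Finset.sum_congr rfl fun x _ => ?_
      rw [map_measureReal_apply hX (measurableSet_singleton x)]
      by_cases h0 : ν.real (X ⁻¹' {x}) = 0
      · have : ν.real (s ∩ X ⁻¹' {x}) ≤ 0 :=
          h0 ▸ measureReal_mono Set.inter_subset_right
        rw [h0, zero_mul]
        exact (le_antisymm this measureReal_nonneg).symm
      · exact mul_div_cancel₀ _ h0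
    have h2 := sum_measureReal_preimage_singleton (μ := ν.restrict s) T.toFinset (f := X)
      (fun y _ => hX (measurableSet_singleton y))
    simp only [Set.coe_toFinset, measureReal_restrict_apply (hX (measurableSet_singleton _)),
      measureReal_restrict_apply (hX hT)] at h2
    rw [h1, setIntegral_indicator hs, setIntegral_const, smul_eq_mul, mul_one, ← h2]
    simp only [Set.inter_comm]
  · exact (hGm.comp (comap_measurable X)).aestronglyMeasurable

variable {Y : Type*} [Fintype Y] [MeasurableSpace Y] [MeasurableSingletonClass Y]

omit [Fintype Y] [MeasurableSingletonClass Y] in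
lemma iSup_piLE : (⨆ k, (Filtration.piLE (X := fun _ : ℕ => Y)) k) = MeasurableSpace.pi := by
  refine le_antisymm (iSup_le fun k => Filtration.le _ k) (iSup_le fun i => ?_)
  refine le_trans ?_ (le_iSup _ i)
  rintro _ ⟨T, hT, rfl⟩
  exact ⟨(fun x => x ⟨i, Set.mem_Iic.2 le_rfl⟩) ⁻¹' T, measurable_pi_apply (⟨i, Set.mem_Iic.2 le_rfl⟩ : Set.Iic i) hT, rfl⟩

/-- The likelihood ratio of mutually singular laws tends to `0`. -/
lemma tendsto_likelihoodRatio {P Q : Measure (ℕ → Y)} [IsFiniteMeasure P] [IsFiniteMeasure Q]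
    (h : Q ⟂ₘ P) :
    ∀ᵐ ω ∂P, Tendsto (fun k => Q.real (cyl ω k) / P.real (cyl ω k)) atTop (𝓝 0) := by
  obtain ⟨s, hs, hQs, hPs⟩ := h
  -- Lévy's upward theorem is applied under P + Q to the indicator of s, a set null for Q and conull
  -- for P. Its conditional probability given the first outcomes is P/(P + Q) on the observed
  -- cylinder, and this tends to 1 on s.
  set ν := P + Q with hR
  have hPν : P ≪ ν := Measure.AbsolutelyContinuous.rfl.add_right Q
  -- The k-th σ-algebra of the filtration sees the times 0, …, k, hence cylinders of length k + 1.
  have hcell : ∀ (ω : ℕ → Y) k, cyl ω (k + 1) =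
      (Preorder.restrictLe (π := fun _ => Y) k) ⁻¹' {Preorder.restrictLe k ω} := by
    intro ω k
    ext ω'
    simp [cyl, funext_iff]
  have hRs : ∀ ω k, ν.real (s ∩ cyl ω k) = P.real (cyl ω k) := by
    intro ω k
    have h1 : Q (s ∩ cyl ω k) = 0 := measure_mono_null Set.inter_subset_left hQs
    have h2 : P (s ∩ cyl ω k) = P (cyl ω k) := by
      rw [Set.inter_comm]
      exact measure_inter_conull hPs
    simp [Measure.real, hR, h1, h2]
  have hcond : ∀ᵐ ω ∂ν, ∀ k, P.real (cyl ω (k + 1)) / ν.real (cyl ω (k + 1)) =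
      (ν[s.indicator (fun _ => (1 : ℝ)) | Filtration.piLE (X := fun _ : ℕ => Y) k]) ω := by
    rw [ae_all_iff]
    intro k
    have hm : Measurable (Preorder.restrictLe (π := fun _ : ℕ => Y) k) :=
      Preorder.measurable_restrictLe k
    filter_upwards [condExp_indicator_comap_ae_eq (ν := ν) hm hs] with ω hω
    rw [← hcell, hRs] at hω
    exact hω
  have hlevy := tendsto_ae_condExp (μ := ν) (ℱ := Filtration.piLE (X := fun _ : ℕ => Y))
    (s.indicator fun _ => (1 : ℝ))
  rw [iSup_piLE, condExp_of_stronglyMeasurable le_rfl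
    (stronglyMeasurable_const.indicator hs) ((integrable_const _).indicator hs)] at hlevy
  have hmem : ∀ᵐ ω ∂P, ω ∈ s := hPs
  filter_upwards [hPν.ae_le hcond, hPν.ae_le hlevy, hmem] with ω h1 h2 h3
  simp only [← h1, Set.indicator_of_mem h3] at h2
  rw [← tendsto_add_atTop_iff_nat 1]
  -- Q/P = (P/(P + Q))⁻¹ - 1.
  have h4 := (h2.inv₀ one_ne_zero).sub_const 1
  rw [inv_one, sub_self] at h4
  refine h4.congr' ?_
  filter_upwards [h2.eventually_ne one_ne_zero] with k hk
  have hP0 : P.real (cyl ω (k + 1)) ≠ 0 := fun h0 => hk (by rw [h0, zero_div])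
  rw [inv_div, hR, measureReal_add_apply, add_div, div_self hP0]
  ring

end LikelihoodRatio

/-! ### The posterior as Bayes' formula -/

section Posterior

open scoped Matrix.Norms.L2Operator MatrixOrder

variable {n Y L : Type*} [Fintype n] [DecidableEq n] [Fintype Y] [Fintype L]

omit [DecidableEq n] [Fintype Y] in
-- By homogeneity the normalisations can be postponed to the end. On a record of weight zero the
-- positive matrix itself vanishes, and the convention 0⁻¹ = 0 makes both sides 0.
lemma trajectory_eq (V : Y → L → Matrix n n ℂ) {ρ : Matrix n n ℂ} (hρ : 0 ≤ ρ)
    (htr : ρ.trace = 1) (ω : ℕ → Y) (k : ℕ) :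
    trajectory V ρ ω k = (unnormalized V ρ ω k).trace⁻¹ • unnormalized V ρ ω k := by
  induction k with
  | zero => simp [trajectory, unnormalized, htr]
  | succ k ih =>
    simp only [trajectory, unnormalized, ih, krausOp_smul, Matrix.trace_smul]
    by_cases h0 : (unnormalized V ρ ω k).trace = 0
    · have := (Matrix.nonneg_iff_posSemidef.1
        (unnormalized_nonneg (V := V) hρ ω k)).trace_eq_zero_iff.1 h0
      simp [this, krausOp]
    · rw [smul_smul, smul_eq_mul, mul_inv, inv_inv, mul_right_comm, mul_inv_cancel₀ h0, one_mul]

variable {Θ : Type*} [Fintype Θ] [DecidableEq Θ]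

omit [DecidableEq n] [Fintype Y] in
lemma unnormalized_blockKraus (V : Θ → Y → L → Matrix n n ℂ) (π₀ : Θ → ℝ) (ρ : Matrix n n ℂ)
    (ω : ℕ → Y) (k : ℕ) :
    unnormalized (blockKraus V) (initialEstimate π₀ ρ) ω k =
      Matrix.blockDiagonal fun p => π₀ p • unnormalized (V p) ρ ω k := by
  induction k with
  | zero => rfl
  | succ k ih =>
    simp only [unnormalized, ih, krausOp, blockKraus, Matrix.blockDiagonal_conjTranspose,
      ← Matrix.blockDiagonal_mul]
    refine (map_sum (Matrix.blockDiagonalAddMonoidHom n n Θ ℂ)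
      (fun μ p => V p (ω k) μ * π₀ p • unnormalized (V p) ρ ω k * (V p (ω k) μ)ᴴ) _).symm.trans ?_
    rw [Matrix.blockDiagonalAddMonoidHom_apply]
    congr 1
    ext1 p
    simp [Finset.smul_sum]

lemma initialEstimate_nonneg {π₀ : Θ → ℝ} (hpos : ∀ p, 0 < π₀ p) {ρ : Matrix n n ℂ} (hρ : 0 ≤ ρ) :
    0 ≤ initialEstimate π₀ ρ := by
  have (p : Θ) : ∃ B : Matrix n n ℂ, (π₀ p : ℂ) • ρ = star B * B :=
    CStarAlgebra.nonneg_iff_eq_star_mul_self.1 (smul_nonneg (hpos p).le hρ : 0 ≤ π₀ p • ρ)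
  choose B hB using this
  have : initialEstimate π₀ ρ = (Matrix.blockDiagonal B)ᴴ * Matrix.blockDiagonal B := by
    rw [initialEstimate, Matrix.blockDiagonal_conjTranspose, ← Matrix.blockDiagonal_mul]
    simp only [hB, Matrix.star_eq_conjTranspose]
  rw [this]
  exact (Matrix.posSemidef_conjTranspose_mul_self _).nonneg

lemma posterior_eq {V : Θ → Y → L → Matrix n n ℂ} (hf : ∀ p, IsFaithful (V p)) {π₀ : Θ → ℝ}
    (hpos : ∀ p, 0 < π₀ p) (hsum : ∑ p, π₀ p = 1) {ρ : Matrix n n ℂ} (hρ : IsState ρ) (ω : ℕ → Y)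
    (k : ℕ) (p : Θ) :
    posterior V π₀ ρ ω k p = π₀ p * (unnormalized (V p) ρ ω k).trace.re /
      ∑ q, π₀ q * (unnormalized (V q) ρ ω k).trace.re := by
  have htr : (initialEstimate π₀ ρ).trace = 1 := by
    simp [initialEstimate, Matrix.trace_blockDiagonal, Matrix.trace_smul, hρ.2,
      ← Complex.ofReal_sum, hsum]
  have hden : (unnormalized (blockKraus V) (initialEstimate π₀ ρ) ω k).trace =
      ((∑ q, π₀ q * (unnormalized (V q) ρ ω k).trace.re : ℝ) : ℂ) := by
    rw [unnormalized_blockKraus, Matrix.trace_blockDiagonal, Complex.ofReal_sum]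
    refine Finset.sum_congr rfl fun q _ => ?_
    rw [Matrix.trace_smul, trace_eq_ofReal (unnormalized_nonneg hρ.1.nonneg ω k)]
    simp
  have hnum : (blockProjector V p *
      unnormalized (blockKraus V) (initialEstimate π₀ ρ) ω k).trace.re =
      π₀ p * (unnormalized (V p) ρ ω k).trace.re := by
    rw [unnormalized_blockKraus, blockProjector, minimalProjector_eq_one (hf p),
      ← Matrix.blockDiagonal_mul, Matrix.trace_blockDiagonal, Finset.sum_eq_single p]
    · simp [Matrix.trace_smul]
    · intro q _ hq
      simp [Pi.single_eq_of_ne hq]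
    · simp
  rw [posterior, estimate, trajectory_eq _ (initialEstimate_nonneg hpos hρ.1.nonneg) htr, hden,
    Matrix.mul_smul, Matrix.trace_smul, ← Complex.ofReal_inv, smul_eq_mul, Complex.re_ofReal_mul,
    hnum, div_eq_inv_mul]

end Posterior

/-! ### From likelihood ratios to posterior weights -/

section PosteriorConsistency

lemma tendsto_div_sum_of_ratio {ι : Type*} [Fintype ι] [DecidableEq ι] {a : ι → ℕ → ℝ} {i : ι}
    (h0 : ∀ᶠ k in atTop, a i k ≠ 0)
    (h : ∀ j, j ≠ i → Tendsto (fun k => a j k / a i k) atTop (𝓝 0)) :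
    Tendsto (fun k => a i k / ∑ j, a j k) atTop (𝓝 1) ∧
      ∀ j, j ≠ i → Tendsto (fun k => a j k / ∑ j, a j k) atTop (𝓝 0) := by
  have hi : Tendsto (fun k => a i k / a i k) atTop (𝓝 1) :=
    tendsto_const_nhds.congr' (h0.mono fun k hk => (div_self hk).symm)
  have hall : ∀ j, Tendsto (fun k => a j k / a i k) atTop (𝓝 (if j = i then 1 else 0)) := by
    intro j
    split_ifs with hj
    · exact hj ▸ hi
    · exact h j hj
  have hs : Tendsto (fun k => (∑ j, a j k) / a i k) atTop (𝓝 1) := by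
    have := tendsto_finsetSum Finset.univ fun j _ => hall j
    simpa [Finset.sum_div] using this
  have hdiv : ∀ j, Tendsto (fun k => a j k / ∑ j, a j k) atTop (𝓝 (if j = i then 1 else 0)) := by
    intro j
    have := (hall j).div hs one_ne_zero
    rw [div_one] at this
    refine this.congr' (h0.mono fun k hk => ?_)
    exact div_div_div_cancel_right₀ hk _ _
  exact ⟨by simpa using hdiv i, fun j hj => by simpa [hj] using hdiv j⟩

variable {n Y L : Type*} [Fintype n] [DecidableEq n] [Fintype Y] [Fintype L] [MeasurableSpace Y]
  [MeasurableSingletonClass Y]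

open scoped MatrixOrder in
lemma law_real_cyl {V : Y → L → Matrix n n ℂ} (hV : IsKraus V) {ρ : Matrix n n ℂ} (hρ : 0 ≤ ρ)
    (ω : ℕ → Y) (k : ℕ) : (law V ρ).real (cyl ω k) = (unnormalized V ρ ω k).trace.re := by
  rw [Measure.real, law_cyl hV hρ, ENNReal.toReal_ofReal
    (trace_re_nonneg (unnormalized_nonneg hρ ω k))]

omit [MeasurableSingletonClass Y] in
-- There are only finitely many cylinders of each length, so the null ones have null union.
lemma ae_measure_cyl_ne_zero (P : Measure (ℕ → Y)) : ∀ᵐ ω ∂P, ∀ k, P (cyl ω k) ≠ 0 := by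
  rw [ae_all_iff]
  intro k
  let X : (ℕ → Y) → Fin k → Y := fun ω i => ω i
  have hcyl : ∀ ω, cyl ω k = X ⁻¹' {X ω} := by
    intro ω
    ext ω'
    simp [cyl, X, funext_iff, Fin.forall_iff]
  have : {ω | ¬ P (cyl ω k) ≠ 0} ⊆ ⋃ x ∈ {x | P (X ⁻¹' {x}) = 0}, X ⁻¹' {x} := by
    intro ω hω
    simp only [ne_eq, not_not, Set.mem_ofPred_eq, hcyl] at hω
    exact Set.mem_biUnion hω rfl
  exact measure_mono_null this ((measure_biUnion_null_iff (Set.to_countable _)).2 fun x hx => hx)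

end PosteriorConsistency

end QTraj

end

open scoped MatrixOrder in
theorem theorem3p1 {d : ℕ} {Θ Y L : Type*} [Fintype Θ] [DecidableEq Θ] [Fintype Y]
    [MeasurableSpace Y] [MeasurableSingletonClass Y] [Fintype L]
    (V : Θ → Y → L → Matrix (Fin d) (Fin d) ℂ)
    (hV : ∀ p, QTraj.IsKraus (V p)) (hfaithful : ∀ p, QTraj.IsFaithful (V p))
    (hID : QTraj.Identifiable V)
    (ρhat : Matrix (Fin d) (Fin d) ℂ) (hρhat : QTraj.IsState ρhat) (hfull : ρhat.PosDef)
    (π₀ : Θ → ℝ) (hpos : ∀ p, 0 < π₀ p) (hsum : ∑ p, π₀ p = 1)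
    (pstar : Θ) (ρ₀ : Matrix (Fin d) (Fin d) ℂ) (hρ₀ : QTraj.IsState ρ₀) :
    ∀ᵐ ω ∂(QTraj.outputLaw (V pstar) ρ₀),
      Tendsto (fun k => QTraj.posterior V π₀ ρhat ω k pstar) atTop (𝓝 1) ∧
      ∀ p, p ≠ pstar → Tendsto (fun k => QTraj.posterior V π₀ ρhat ω k p) atTop (𝓝 0) := by
  have hρ : 0 ≤ ρhat := hρhat.1.nonneg
  -- Full rank of `ρhat` makes the true law absolutely continuous with respect to the one started
  -- from `ρhat`, so the almost sure statement need only be proved for the latter.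
  have hac := QTraj.law_absolutelyContinuous (hV pstar) hρ₀.1.nonneg hρ
    (QTraj.support_eq_top hfull ▸ le_top)
  rw [QTraj.law_eq_outputLaw hρ₀] at hac
  refine hac.ae_le ?_
  have hratio : ∀ᵐ ω ∂(QTraj.law (V pstar) ρhat), ∀ p, p ≠ pstar →
      Tendsto (fun k => (QTraj.law (V p) ρhat).real (QTraj.cyl ω k) /
        (QTraj.law (V pstar) ρhat).real (QTraj.cyl ω k)) atTop (𝓝 0) := by
    rw [ae_all_iff]
    intro p
    by_cases hp : p = pstar
    · simp [hp]
    · filter_upwards [QTraj.tendsto_likelihoodRatio (hID.mutuallySingular hV hfaithful hp hρ hρ)]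
        with ω hω _ using hω
  filter_upwards [hratio, QTraj.ae_measure_cyl_ne_zero (QTraj.law (V pstar) ρhat)] with ω hω h0
  simp only [QTraj.posterior_eq hfaithful hpos hsum hρhat]
  refine QTraj.tendsto_div_sum_of_ratio
    (a := fun p k => π₀ p * (QTraj.unnormalized (V p) ρhat ω k).trace.re) ?_ ?_
  · refine Eventually.of_forall fun k => mul_ne_zero (hpos pstar).ne' ?_
    rw [← QTraj.law_real_cyl (hV pstar) hρ]
    exact ENNReal.toReal_ne_zero.2 ⟨h0 k, measure_ne_top _ _⟩
  · intro p hp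
    have := (hω p hp).const_mul (π₀ p / π₀ pstar)
    simp only [QTraj.law_real_cyl (hV _) hρ, mul_zero] at this
    refine this.congr fun k => ?_
    rw [div_mul_div_comm]
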